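/- Let $g(t)=2^{1/4}e^{-\pi t^2}$. For a tempered distribution $y$ on $\mathbb{R}$ and $z=\tau+i\omega\in\mathbb{C}$, let $$\mathrm{Spec}_g(y)(z)=\left|\int_{\mathbb{R}} y(t)\,g(t-\tau)\,e^{-2i\pi\omega t}\,\mathrm{d}t\right|^2 ,$$ where the integral denotes the pairing of $y$ with the Schwartz function $t\mapsto g(t-\tau)e^{-2i\pi\omega t}$. Let $\xi$ be a complex white Gaussian noise on $\mathbb{R}$, i.e. a random tempered distribution such that, for every Schwartz function $\varphi$, $\langle \xi,\varphi\rangle$ is a circularly-symmetric complex Gaussian variable with $\mathbb{E}|\langle\xi,\varphi\rangle|^2=\|\varphi\|_{L^2}^2$. Let $k\geq 1$ be an integer and $\gamma>0$. Let $h_k$ be the $k$-th Hermite function, i.e. $h_k=c\,H_k\,g$, where $H_k$ is the degree-$k$ orthogonal polynomial with respect to the weight $e^{-2\pi t^2}$ and the constant $c$ is such that $\|h_k\|_{L^2}=1$. For a bounded Borel set $A\subset\mathbb{C}$, let $N(A)$ be the number of zeros of $\mathrm{Spec}_g(\xi+\sqrt{\gamma}\,h_k)$ in $A$. Then the zeros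 have an intensity with respect to Lebesgue measure that depends on $z$ only through $r=\pi|z|^2$: for every bounded Borel set $A$, $$\mathbb{E}[N(A)]=\int_A \rho(\pi|z|^2)\,\mathrm{d}z ,\qquad \rho(r)=\left(1+\gamma\,\frac{r^{k-1}}{k!}\,(k-r)^2e^{-r}\right)\exp\left(-\gamma\,\frac{r^k}{k!}\,e^{-r}\right).$$ -/

import Mathlib

open MeasureTheory ProbabilityTheory
open scoped SchwartzMap ENNReal NNReal

noncomputable section

namespace NoisySpectrogram

/-! ### The Gaussian window and the short-time Fourier transform -/

/-- The Gaussian window `g(t) = 2^{1/4} exp(-π t²)`. -/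
def gaussWindow (t : ℝ) : ℝ := (2 : ℝ) ^ (1 / 4 : ℝ) * Real.exp (-Real.pi * t ^ 2)

/-- The function `t ↦ g(t - τ) exp(-2iπωt)`, where `z = τ + iω`. -/
def atomFun (z : ℂ) (t : ℝ) : ℂ :=
  (gaussWindow (t - z.re) : ℂ) * Complex.exp (-2 * Complex.I * Real.pi * z.im * t)

theorem atomFun_eq (z : ℂ) (t : ℝ) :
    atomFun z t = ((2 : ℝ) ^ (1 / 4 : ℝ) : ℝ) *
      Complex.exp (-Real.pi * (t - z.re) ^ 2 + -2 * Complex.I * Real.pi * z.im * t) := by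
  rw [atomFun, gaussWindow, Complex.exp_add]
  push_cast
  ring

theorem contDiff_atomFun (z : ℂ) {n : WithTop ℕ∞} : ContDiff ℝ n (atomFun z) := by
  have h : atomFun z = fun t : ℝ => (((2 : ℝ) ^ (1 / 4 : ℝ) : ℝ) : ℂ) *
      Complex.exp (-Real.pi * ((t : ℂ) - z.re) ^ 2 + -2 * Complex.I * Real.pi * z.im * t) :=
    funext (atomFun_eq z)
  have h0 : ContDiff ℝ n (fun t : ℝ => (t : ℂ)) := Complex.ofRealCLM.contDiff
  rw [h]
  fun_prop

theorem hasDerivAt_atomFun (z : ℂ) (t : ℝ) :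
    HasDerivAt (atomFun z)
      ((-2 * Real.pi * (t - z.re) - 2 * Complex.I * Real.pi * z.im) * atomFun z t) t := by
  have h : atomFun z = fun t : ℝ => (((2 : ℝ) ^ (1 / 4 : ℝ) : ℝ) : ℂ) *
      Complex.exp (-Real.pi * ((t : ℂ) - z.re) ^ 2 + -2 * Complex.I * Real.pi * z.im * t) :=
    funext (atomFun_eq z)
  have h0 : HasDerivAt (fun t : ℝ => (t : ℂ)) 1 t := Complex.ofRealCLM.hasDerivAt
  rw [h]
  have h1 := ((((h0.sub_const (z.re : ℂ)).pow 2).const_mul (-Real.pi : ℂ)).add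
    (h0.const_mul (-2 * Complex.I * Real.pi * z.im))).cexp.const_mul
      (((2 : ℝ) ^ (1 / 4 : ℝ) : ℝ) : ℂ)
  refine h1.congr_deriv ?_
  simp only [Pi.add_apply, Pi.pow_apply]
  push_cast
  ring

theorem iteratedDeriv_atomFun (z : ℂ) (n : ℕ) :
    ∃ Q : Polynomial ℂ, ∀ t : ℝ,
      iteratedDeriv n (atomFun z) t = Q.eval (t - z.re : ℂ) * atomFun z t := by
  induction n with
  | zero => exact ⟨1, fun t => by simp⟩
  | succ n ih =>
    obtain ⟨Q, hQ⟩ := ih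
    refine ⟨Polynomial.derivative Q + Q * (Polynomial.C (-2 * Real.pi : ℂ) * Polynomial.X -
      Polynomial.C (2 * Complex.I * Real.pi * z.im)), fun t => ?_⟩
    rw [iteratedDeriv_succ, funext hQ]
    have h0 : HasDerivAt (fun t : ℝ => (t : ℂ) - z.re) 1 t :=
      (Complex.ofRealCLM.hasDerivAt (x := t)).sub_const _
    have h1 : HasDerivAt (fun t : ℝ => Q.eval ((t : ℂ) - z.re))
        ((Polynomial.derivative Q).eval ((t : ℂ) - z.re) * 1) t :=
      HasDerivAt.comp (h₂ := fun w : ℂ => Q.eval w) (h := fun t : ℝ => (t : ℂ) - z.re) t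
        (Q.hasDerivAt ((t : ℂ) - z.re)) h0
    have h2 : HasDerivAt (fun t : ℝ => Q.eval ((t : ℂ) - z.re) * atomFun z t) _ t :=
      h1.mul (hasDerivAt_atomFun z t)
    rw [h2.deriv]
    simp only [Polynomial.eval_add, Polynomial.eval_mul, Polynomial.eval_sub, Polynomial.eval_C,
      Polynomial.eval_X]
    ring

theorem norm_atomFun (z : ℂ) (t : ℝ) : ‖atomFun z t‖ = gaussWindow (t - z.re) := by
  have h : -2 * Complex.I * Real.pi * z.im * t =
      ((-2 * Real.pi * z.im * t : ℝ) : ℂ) * Complex.I := by push_cast; ring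
  rw [atomFun, norm_mul, h, Complex.norm_exp_ofReal_mul_I, mul_one, Complex.norm_real,
    Real.norm_of_nonneg]
  unfold gaussWindow
  positivity

theorem pow_mul_gaussWindow_le (m : ℕ) (s : ℝ) :
    |s| ^ m * gaussWindow s ≤ (1 + m.factorial) * (2 : ℝ) ^ (1 / 4 : ℝ) := by
  have h1 : |s| ^ m ≤ 1 + (s ^ 2) ^ m := by
    have h : (s ^ 2) ^ m = (|s| ^ m) ^ 2 := by rw [← sq_abs s, ← pow_mul, ← pow_mul, mul_comm]
    rw [h]
    nlinarith [sq_nonneg (|s| ^ m - 1), pow_nonneg (abs_nonneg s) m]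
  have hpi : (1 : ℝ) ≤ Real.pi := by linarith [Real.pi_gt_three]
  have h2 : (s ^ 2) ^ m ≤ m.factorial * Real.exp (Real.pi * s ^ 2) := by
    have h := Real.pow_div_factorial_le_exp (s ^ 2) (sq_nonneg s) m
    rw [div_le_iff₀ (by positivity), mul_comm] at h
    refine h.trans ?_
    gcongr
    nlinarith [sq_nonneg s]
  have h3 : (1 : ℝ) ≤ Real.exp (Real.pi * s ^ 2) := Real.one_le_exp (by positivity)
  have h4 : |s| ^ m ≤ (1 + m.factorial) * Real.exp (Real.pi * s ^ 2) := by linarith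
  have h5 : Real.exp (Real.pi * s ^ 2) * Real.exp (-Real.pi * s ^ 2) = 1 := by
    rw [← Real.exp_add]; simp
  calc |s| ^ m * gaussWindow s
      ≤ ((1 + m.factorial) * Real.exp (Real.pi * s ^ 2)) * gaussWindow s :=
        mul_le_mul_of_nonneg_right h4 (by unfold gaussWindow; positivity)
    _ = (1 + m.factorial) * (2 : ℝ) ^ (1 / 4 : ℝ) *
          (Real.exp (Real.pi * s ^ 2) * Real.exp (-Real.pi * s ^ 2)) := by
        unfold gaussWindow; ring
    _ = _ := by rw [h5, mul_one]

theorem bounded_polynomial_mul_gaussWindow (Q : Polynomial ℂ) :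
    ∃ C : ℝ, ∀ s : ℝ, ‖Q.eval (s : ℂ)‖ * gaussWindow s ≤ C := by
  refine ⟨∑ i ∈ Q.support, ‖Q.coeff i‖ * ((1 + i.factorial) * (2 : ℝ) ^ (1 / 4 : ℝ)),
    fun s => ?_⟩
  have hg : 0 ≤ gaussWindow s := by unfold gaussWindow; positivity
  rw [Polynomial.eval_eq_sum, Polynomial.sum]
  refine (mul_le_mul_of_nonneg_right (norm_sum_le _ _) hg).trans ?_
  rw [Finset.sum_mul]
  refine Finset.sum_le_sum fun i _ => ?_
  rw [norm_mul, norm_pow, Complex.norm_real, Real.norm_eq_abs, mul_assoc]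
  exact mul_le_mul_of_nonneg_left (pow_mul_gaussWindow_le i s) (norm_nonneg _)

/-- The Schwartz function `t ↦ g(t - τ) exp(-2iπωt)`, where `z = τ + iω`. -/
def atom (z : ℂ) : 𝓢(ℝ, ℂ) where
  toFun := atomFun z
  smooth' := contDiff_atomFun z
  decay' k n := by
    obtain ⟨Q, hQ⟩ := iteratedDeriv_atomFun z n
    obtain ⟨C, hC⟩ := bounded_polynomial_mul_gaussWindow
      ((Polynomial.X + Polynomial.C (z.re : ℂ)) ^ k * Q)
    refine ⟨C, fun t => ?_⟩
    rw [norm_iteratedFDeriv_eq_norm_iteratedDeriv, hQ, norm_mul, norm_atomFun, ← mul_assoc]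
    have h := hC (t - z.re)
    simpa using h

/-- The short-time Fourier transform, with Gaussian window, of a tempered distribution `y`, at
`z = τ + iω`: the value of `y` at the test function `t ↦ g(t - τ) exp(-2iπωt)`. When `y` is a
function, this is `∫ y(t) g(t - τ) exp(-2iπωt) dt`. -/
def stft (y : 𝓢'(ℝ, ℂ)) (z : ℂ) : ℂ := y (atom z)

/-- The definition agrees with the integral formula for square-integrable signals. -/
theorem stft_coe (x : Lp ℂ 2 (volume : Measure ℝ)) (z : ℂ) :
    stft (x : 𝓢'(ℝ, ℂ)) z =
      ∫ t : ℝ, x t * gaussWindow (t - z.re) *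
        Complex.exp (-2 * Complex.I * Real.pi * z.im * t) := by
  rw [stft, Lp.toTemperedDistribution_apply]
  refine integral_congr_ae (Filter.Eventually.of_forall fun t => ?_)
  change atomFun z t • x t = _
  rw [atomFun, smul_eq_mul]
  ring

/-- The spectrogram, with Gaussian window, of a tempered distribution. -/
def spectrogram (y : 𝓢'(ℝ, ℂ)) (z : ℂ) : ℝ := ‖stft y z‖ ^ 2

/-! ### Complex white Gaussian noise -/

/-- The circularly-symmetric complex Gaussian law with mean `0` and variance `v` (that is,
`E|Z|² = v`): the real and imaginary parts are independent and `N(0, v/2)`. -/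
def complexGaussian (v : ℝ≥0) : Measure ℂ :=
  ((gaussianReal 0 (v / 2)).prod (gaussianReal 0 (v / 2))).map
    (fun p : ℝ × ℝ => (p.1 : ℂ) + p.2 * Complex.I)

/-- A complex white Gaussian noise: a random tempered distribution `ξ` such that, for every test
function `φ`, the pairing `⟨ξ, φ⟩` is circularly-symmetric complex Gaussian with variance
`‖φ‖²` (the squared `L²` norm). Since `φ ↦ ⟨ξ, φ⟩` is complex linear, this determines all the joint
laws of the pairings, hence the law of `ξ`. -/
def IsComplexWhiteNoise {Ω : Type*} [MeasurableSpace Ω] (P : Measure Ω) (ξ : Ω → 𝓢'(ℝ, ℂ)) :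
    Prop :=
  ∀ φ : 𝓢(ℝ, ℂ),
    HasLaw (fun ω => ξ ω φ) (complexGaussian (Real.toNNReal (∫ t : ℝ, ‖φ t‖ ^ 2))) P

/-! ### Hermite functions -/

/-- `H` is a `k`-th orthogonal polynomial with respect to the weight `exp(-2πt²)`. -/
def IsOrthogonalPolynomial (k : ℕ) (H : Polynomial ℝ) : Prop :=
  H.degree = k ∧ ∀ q : Polynomial ℝ, q.degree < k →
    ∫ t : ℝ, H.eval t * q.eval t * Real.exp (-2 * Real.pi * t ^ 2) = 0

/-- `h` is a `k`-th Hermite function: `h ∝ H g`, where `H` is a `k`-th orthogonal polynomial with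
respect to `exp(-2πt²)` and `g` is the Gaussian window, normalized by `‖h‖₂ = 1`. -/
def IsHermiteFunction (k : ℕ) (h : Lp ℂ 2 (volume : Measure ℝ)) : Prop :=
  ‖h‖ = 1 ∧ ∃ H : Polynomial ℝ, IsOrthogonalPolynomial k H ∧
    ∃ c : ℂ, ∀ᵐ t : ℝ, h t = c * (H.eval t * gaussWindow t : ℝ)

/-! ### The intensity of the zeros -/

/-- The number `N(A)` of zeros of the spectrogram of `y` in `A`. -/
def zeroCount (y : 𝓢'(ℝ, ℂ)) (A : Set ℂ) : ℝ≥0∞ :=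
  ({z | z ∈ A ∧ spectrogram y z = 0}.encard : ℝ≥0∞)

/-- `ρ` is the intensity function of the zeros of the spectrogram of the random signal `Y`: the
density with respect to the Lebesgue measure of `A ↦ E[N(A)]`. In particular `N(A)` is a random
variable for every bounded Borel set `A`. -/
structure IsZeroIntensity {Ω : Type*} [MeasurableSpace Ω] (P : Measure Ω) (Y : Ω → 𝓢'(ℝ, ℂ))
    (ρ : ℂ → ℝ) : Prop where
  measurable : Measurable ρ
  nonneg : ∀ z, 0 ≤ ρ z
  aemeasurable_zeroCount : ∀ A : Set ℂ, MeasurableSet A → Bornology.IsBounded A →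
    AEMeasurable (fun ω => zeroCount (Y ω) A) P
  lintegral_zeroCount : ∀ A : Set ℂ, MeasurableSet A → Bornology.IsBounded A →
    ∫⁻ ω, zeroCount (Y ω) A ∂P = ∫⁻ z in A, ENNReal.ofReal (ρ z)

end NoisySpectrogram

end

/-!
The Bargmann transform `w ↦ y (coherent w)` of a tempered distribution `y` is an entire function, and
up to a non-vanishing factor and complex conjugation it is the short-time Fourier transform with
Gaussian window (`spectrogram_eq_zero_iff`, `hasDerivAt_bargmann`). The zeros to be counted are
therefore those of the random entire function `F = m + B`, where `B` is the Bargmann transform of the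
noise and `m` that of the signal. Orthogonality against the Gaussian weight makes `m` a monomial,
`m w = σ w ^ k` with `‖σ‖² = γ π ^ k / k!` (`IsHermiteFunction.exists_bargmann_eq`).

The coherent states have the Bargmann kernel `exp (π w (conj v))` as Gram matrix, so `B 0` is
orthogonal to every increment `B w - B 0`. For white noise orthogonality gives independence
(`IsComplexWhiteNoise.indepFun`): `B 0` is a standard complex Gaussian variable independent of the
whole process `G = F - B 0`. Given `G`, the zeros of `F` in `A` are the preimages in `A` of the
Gaussian point `-B 0` under `G`, and the area formula (`lintegral_count_preimage_mul`) gives their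
expected number as `∫_A ‖G'‖² p(G)`, with `p` the standard complex Gaussian density. The area formula
counts preimages without multiplicity, and by itself discards the critical values, so that the
simplicity of the zeros need not be proved. By Tonelli's theorem the intensity is the average of
`‖G'(w)‖² p(G(w))`, a Gaussian integral in the two variables `B w - B 0` and `B'(w)`
(`lintegral_norm_sq_mul_density_eq_zeroIntensity`).

The use of Fubini's theorem requires the number of zeros to be a measurable function of countably many
values of the process; this is `exists_measurable_count_zeros`.
-/

namespace NoisySpectrogram

open Polynomial ComplexConjugate

/-! ### Coherent states and holomorphy of the Bargmann transform -/

/-- The coherent state `t ↦ 2^{1/4} exp(-πt² + 2πwt - πw²/2)`, as a Schwartz function. It is a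
scalar multiple of `atom (conj w)`, normalized so as to depend holomorphically on `w`; the pairing
`w ↦ y (coherent w)` is the Bargmann transform of `y`. -/
noncomputable def coherent (w : ℂ) : 𝓢(ℝ, ℂ) :=
  Complex.exp (Real.pi / 2 * (w * conj w) - Complex.I * Real.pi * w.re * w.im) • atom (conj w)

theorem coherent_apply (w : ℂ) (t : ℝ) :
    coherent w t = ((2 : ℝ) ^ (1 / 4 : ℝ) : ℝ) *
      Complex.exp (-Real.pi * t ^ 2 + 2 * Real.pi * w * t - Real.pi * w ^ 2 / 2) := by
  change Complex.exp _ * atomFun (conj w) t = _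
  rw [atomFun_eq, mul_left_comm, ← Complex.exp_add]
  congr 2
  have hw := Complex.re_add_im w
  have hc : conj w = w.re - w.im * Complex.I := by
    conv_lhs => rw [← hw]
    apply Complex.ext <;> simp
  rw [hc, Complex.sub_re, Complex.sub_im]
  simp only [Complex.ofReal_re, Complex.ofReal_im, Complex.mul_re, Complex.mul_im, Complex.I_re,
    Complex.I_im]
  generalize w.re = x at *
  generalize w.im = y at *
  rw [← hw]
  push_cast
  ring

theorem stft_eq (y : 𝓢'(ℝ, ℂ)) (z : ℂ) :
    stft y z = Complex.exp (-(Real.pi / 2 * (conj z * z) -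
      Complex.I * Real.pi * (conj z).re * (conj z).im)) * y (coherent (conj z)) := by
  rw [stft, coherent, map_smul, smul_eq_mul, ← mul_assoc, ← Complex.exp_add, Complex.conj_conj]
  simp

theorem spectrogram_eq_zero_iff (y : 𝓢'(ℝ, ℂ)) (z : ℂ) :
    spectrogram y z = 0 ↔ y (coherent (conj z)) = 0 := by
  rw [spectrogram, stft_eq]
  simp

theorem hasDerivAt_coherent (w : ℂ) (t : ℝ) :
    HasDerivAt (coherent w) (-2 * Real.pi * (t - w) * coherent w t) t := by
  have h : (coherent w : ℝ → ℂ) = fun t : ℝ => (((2 : ℝ) ^ (1 / 4 : ℝ) : ℝ) : ℂ) *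
      Complex.exp (-Real.pi * (t : ℂ) ^ 2 + 2 * Real.pi * w * t - Real.pi * w ^ 2 / 2) :=
    funext (coherent_apply w)
  have h0 : HasDerivAt (fun t : ℝ => (t : ℂ)) 1 t := Complex.ofRealCLM.hasDerivAt
  rw [h]
  have h1 := (((((h0.pow 2).const_mul (-Real.pi : ℂ)).add
    (h0.const_mul (2 * Real.pi * w))).sub_const (Real.pi * w ^ 2 / 2)).cexp.const_mul
      (((2 : ℝ) ^ (1 / 4 : ℝ) : ℝ) : ℂ))
  refine h1.congr_deriv ?_
  simp only [Pi.add_apply, Pi.pow_apply]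
  push_cast
  ring

theorem hasDerivAt_coherent_param (w : ℂ) (t : ℝ) :
    HasDerivAt (fun w => coherent w t) ((2 * Real.pi * t - Real.pi * w) * coherent w t) w := by
  have h : (fun w => coherent w t) = fun w : ℂ => (((2 : ℝ) ^ (1 / 4 : ℝ) : ℝ) : ℂ) *
      Complex.exp (-Real.pi * (t : ℂ) ^ 2 + 2 * Real.pi * w * t - Real.pi * w ^ 2 / 2) :=
    funext fun w => coherent_apply w t
  have h0 : HasDerivAt (fun w : ℂ => w) 1 w := hasDerivAt_id w
  rw [h, coherent_apply]
  have h1 := ((((h0.const_mul (2 * Real.pi : ℂ)).mul_const (t : ℂ)).const_add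
    (-Real.pi * (t : ℂ) ^ 2)).sub (((h0.pow 2).const_mul (Real.pi : ℂ)).div_const 2)).cexp.const_mul
      (((2 : ℝ) ^ (1 / 4 : ℝ) : ℝ) : ℂ)
  refine h1.congr_deriv ?_
  simp only [Pi.pow_apply, Pi.sub_apply]
  push_cast
  ring

/-- The polynomials `Q` for which the `n`-th derivative of `coherent w` at `t` is
`Q n (t - w) * coherent w t`. -/
noncomputable def coherentDerivPoly : ℕ → ℂ[X]
  | 0 => 1
  | n + 1 => derivative (coherentDerivPoly n) - C (2 * Real.pi : ℂ) * X * coherentDerivPoly n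

theorem hasDerivAt_polynomial_sub (Q : ℂ[X]) (w : ℂ) (t : ℝ) :
    HasDerivAt (fun t : ℝ => Q.eval ((t : ℂ) - w)) ((derivative Q).eval ((t : ℂ) - w)) t := by
  have h0 : HasDerivAt (fun t : ℝ => (t : ℂ) - w) 1 t :=
    (Complex.ofRealCLM.hasDerivAt (x := t)).sub_const _
  have h1 := HasDerivAt.comp (h₂ := fun w : ℂ => Q.eval w) (h := fun t : ℝ => (t : ℂ) - w) t
    (Q.hasDerivAt ((t : ℂ) - w)) h0
  rwa [mul_one] at h1

theorem iteratedDeriv_coherent (w : ℂ) (n : ℕ) (t : ℝ) :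
    iteratedDeriv n (coherent w) t = (coherentDerivPoly n).eval ((t : ℂ) - w) * coherent w t := by
  induction n generalizing t with
  | zero => simp [coherentDerivPoly]
  | succ n ih =>
    rw [iteratedDeriv_succ, funext ih,
      ((hasDerivAt_polynomial_sub (coherentDerivPoly n) w t).fun_mul (hasDerivAt_coherent w t)).deriv]
    simp only [coherentDerivPoly, eval_sub, eval_mul, eval_C, eval_X]
    ring

/-- The derivative of the coherent state with respect to its parameter, the Schwartz function
`t ↦ (2πt - πw) coherent w t`. -/
noncomputable def coherentDeriv (w : ℂ) : 𝓢(ℝ, ℂ) :=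
  (Real.pi * w : ℂ) • coherent w - SchwartzMap.derivCLM ℂ ℂ (coherent w)

theorem coherentDeriv_apply (w : ℂ) (t : ℝ) :
    coherentDeriv w t = (2 * Real.pi * t - Real.pi * w) * coherent w t := by
  rw [coherentDeriv, sub_apply, smul_apply, SchwartzMap.derivCLM_apply,
    (hasDerivAt_coherent w t).deriv, smul_eq_mul]
  ring

theorem iteratedDeriv_coherentDeriv (w : ℂ) (n : ℕ) (t : ℝ) :
    iteratedDeriv n (coherentDeriv w) t = Real.pi * w * iteratedDeriv n (coherent w) t -
      iteratedDeriv (n + 1) (coherent w) t := by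
  have h : (coherentDeriv w : ℝ → ℂ) =
      (fun t => (Real.pi * w : ℂ) * coherent w t) - deriv (coherent w) := by
    ext t
    simp [coherentDeriv, SchwartzMap.derivCLM_apply]
  have hd : ContDiff ℝ n (deriv (coherent w)) :=
    (SchwartzMap.derivCLM ℂ ℂ (coherent w)).smooth n
  rw [h, iteratedDeriv_sub (ContDiff.contDiffAt (contDiff_const.mul ((coherent w).smooth n)))
    hd.contDiffAt, iteratedDeriv_const_mul_field, iteratedDeriv_succ']

theorem hasDerivAt_iteratedDeriv_coherent (w : ℂ) (n : ℕ) (t : ℝ) :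
    HasDerivAt (fun w => iteratedDeriv n (coherent w) t) (iteratedDeriv n (coherentDeriv w) t)
      w := by
  have h0 : HasDerivAt (fun w : ℂ => (t : ℂ) - w) (-1) w := by
    simpa using (hasDerivAt_id w).const_sub (t : ℂ)
  have h1 := HasDerivAt.comp (h₂ := fun w : ℂ => (coherentDerivPoly n).eval w) w
    ((coherentDerivPoly n).hasDerivAt ((t : ℂ) - w)) h0
  simp_rw [iteratedDeriv_coherentDeriv, iteratedDeriv_coherent]
  refine (h1.fun_mul (hasDerivAt_coherent_param w t)).congr_deriv ?_
  simp only [coherentDerivPoly, eval_sub, eval_mul, eval_C, eval_X, Function.comp_apply]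
  ring

theorem norm_coherent (w : ℂ) (t : ℝ) :
    ‖coherent w t‖ = Real.exp (Real.pi / 2 * ‖w‖ ^ 2) * gaussWindow (t - w.re) := by
  change ‖Complex.exp _ * atomFun (conj w) t‖ = _
  rw [norm_mul, norm_atomFun, Complex.norm_exp, Complex.mul_conj, Complex.normSq_eq_norm_sq,
    Complex.conj_re]
  congr 2
  simp [-Complex.ofReal_pow]

theorem exists_bound_iteratedDeriv_coherent (R : ℝ) (k n : ℕ) :
    ∃ C : ℝ, ∀ w : ℂ, ‖w‖ ≤ R → ∀ t : ℝ, |t| ^ k * ‖iteratedDeriv n (coherent w) t‖ ≤ C := by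
  rcases lt_or_ge R 0 with hR | hR
  · exact ⟨0, fun w hw => absurd (hw.trans_lt hR) (not_lt.2 (norm_nonneg w))⟩
  set Q := coherentDerivPoly n
  obtain ⟨M, hM⟩ := bounded_polynomial_mul_gaussWindow
    ((X + C (R : ℂ)) ^ k * ∑ i ∈ Q.support, C ((‖Q.coeff i‖ : ℝ) : ℂ) * (X + C (R : ℂ)) ^ i)
  refine ⟨Real.exp (Real.pi / 2 * R ^ 2) * M, fun w hw t => ?_⟩
  set s := t - w.re
  have h1 : |t| ≤ |s| + R := by
    have h2 : t = s + w.re := by simp [s]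
    calc |t| = |s + w.re| := by rw [← h2]
      _ ≤ |s| + |w.re| := abs_add_le _ _
      _ ≤ |s| + R := by gcongr; exact (Complex.abs_re_le_norm w).trans hw
  have h2 : ‖(t : ℂ) - w‖ ≤ |s| + R := by
    have h3 : (t : ℂ) - w = s - w.im * Complex.I := by
      conv_lhs => rw [← Complex.re_add_im w]
      simp only [s]
      push_cast
      ring
    rw [h3]
    refine (norm_sub_le _ _).trans ?_
    rw [norm_mul, Complex.norm_I, mul_one, Complex.norm_real, Complex.norm_real, Real.norm_eq_abs,
      Real.norm_eq_abs]
    gcongr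
    exact (Complex.abs_im_le_norm w).trans hw
  have h3 : ‖Q.eval ((t : ℂ) - w)‖ ≤ ∑ i ∈ Q.support, ‖Q.coeff i‖ * (|s| + R) ^ i := by
    rw [eval_eq_sum, Polynomial.sum]
    refine (norm_sum_le _ _).trans (Finset.sum_le_sum fun i _ => ?_)
    rw [norm_mul, norm_pow]
    gcongr
  have hg : gaussWindow |s| = gaussWindow s := by simp [gaussWindow]
  have hg0 : 0 ≤ gaussWindow s := by unfold gaussWindow; positivity
  have h4 := hM |s|
  have h5 : ‖((X + C (R : ℂ)) ^ k *
      ∑ i ∈ Q.support, C ((‖Q.coeff i‖ : ℝ) : ℂ) * (X + C (R : ℂ)) ^ i).eval ((|s| : ℝ) : ℂ)‖ =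
      (|s| + R) ^ k * ∑ i ∈ Q.support, ‖Q.coeff i‖ * (|s| + R) ^ i := by
    have h6 : (0 : ℝ) ≤ (|s| + R) ^ k * ∑ i ∈ Q.support, ‖Q.coeff i‖ * (|s| + R) ^ i := by
      positivity
    rw [← Real.norm_of_nonneg h6, ← Complex.norm_real]
    congr 1
    push_cast
    simp only [eval_mul, eval_pow, eval_add, eval_X, eval_C, eval_finsetSum]
  rw [h5, hg] at h4
  rw [iteratedDeriv_coherent, norm_mul, norm_coherent]
  calc |t| ^ k * (‖Q.eval ((t : ℂ) - w)‖ * (Real.exp (Real.pi / 2 * ‖w‖ ^ 2) * gaussWindow s))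
      ≤ (|s| + R) ^ k * ((∑ i ∈ Q.support, ‖Q.coeff i‖ * (|s| + R) ^ i) *
          (Real.exp (Real.pi / 2 * R ^ 2) * gaussWindow s)) := by gcongr
    _ = Real.exp (Real.pi / 2 * R ^ 2) * ((|s| + R) ^ k *
          (∑ i ∈ Q.support, ‖Q.coeff i‖ * (|s| + R) ^ i) * gaussWindow s) := by ring
    _ ≤ _ := by gcongr

/-- The quadratic Taylor remainder of an entire function, from Cauchy's estimates. -/
theorem norm_taylor_remainder_le {f : ℂ → ℂ} (hf : Differentiable ℂ f) {w h : ℂ} {C : ℝ}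
    (hC : ∀ v, ‖v - w‖ ≤ 3 → ‖f v‖ ≤ C) (hh : ‖h‖ ≤ 1) :
    ‖f (w + h) - f w - h * deriv f w‖ ≤ C * ‖h‖ ^ 2 := by
  have hf' : Differentiable ℂ (deriv f) := fun z =>
    ((hf.differentiableOn.deriv isOpen_univ) z trivial).differentiableAt Filter.univ_mem
  have h1 : ∀ v, ‖v - w‖ ≤ 2 → ‖deriv f v‖ ≤ C := fun v hv => by
    simpa using Complex.norm_deriv_le_of_forall_mem_sphere_norm_le one_pos hf.diffContOnCl
      (fun z hz => hC z (by
        have : ‖z - v‖ = 1 := by simpa [dist_eq_norm] using hz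
        calc ‖z - w‖ = ‖(z - v) + (v - w)‖ := by ring_nf
          _ ≤ ‖z - v‖ + ‖v - w‖ := norm_add_le _ _
          _ ≤ 3 := by linarith))
  have h2 : ∀ v, ‖v - w‖ ≤ 1 → ‖deriv (deriv f) v‖ ≤ C := fun v hv => by
    simpa using Complex.norm_deriv_le_of_forall_mem_sphere_norm_le one_pos hf'.diffContOnCl
      (fun z hz => h1 z (by
        have : ‖z - v‖ = 1 := by simpa [dist_eq_norm] using hz
        calc ‖z - w‖ = ‖(z - v) + (v - w)‖ := by ring_nf
          _ ≤ ‖z - v‖ + ‖v - w‖ := norm_add_le _ _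
          _ ≤ 2 := by linarith))
  have hball : ∀ v ∈ Metric.closedBall w ‖h‖, ‖v - w‖ ≤ ‖h‖ := fun v hv => by
    simpa [dist_eq_norm] using hv
  have hw : w ∈ Metric.closedBall w ‖h‖ := by simp
  have h3 : ∀ v ∈ Metric.closedBall w ‖h‖, ‖deriv f v - deriv f w‖ ≤ C * ‖h‖ := fun v hv => by
    refine ((convex_closedBall w ‖h‖).norm_image_sub_le_of_norm_deriv_le
      (fun z _ => hf' z) (fun z hz => h2 z ((hball z hz).trans hh)) hw hv).trans ?_
    have hC0 : 0 ≤ C := (norm_nonneg _).trans (hC w (by simp))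
    gcongr
    exact hball v hv
  have h4 : ∀ v, HasDerivAt (fun v => f v - v * deriv f w) (deriv f v - deriv f w) v := fun v => by
    simpa using (hf v).hasDerivAt.fun_sub ((hasDerivAt_id v).mul_const (deriv f w))
  have h5 := (convex_closedBall w ‖h‖).norm_image_sub_le_of_norm_hasDerivWithin_le
    (fun v _ => (h4 v).hasDerivWithinAt) h3 hw
    (y := w + h) (by simp)
  calc ‖f (w + h) - f w - h * deriv f w‖
      = ‖f (w + h) - (w + h) * deriv f w - (f w - w * deriv f w)‖ := by ring_nf
    _ ≤ _ := h5
    _ = C * ‖h‖ ^ 2 := by rw [add_sub_cancel_left]; ring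

theorem exists_seminorm_remainder_le (w : ℂ) (k n : ℕ) :
    ∃ C : ℝ, 0 ≤ C ∧ ∀ h : ℂ, ‖h‖ ≤ 1 →
      SchwartzMap.seminorm ℂ k n (coherent (w + h) - coherent w - h • coherentDeriv w) ≤
        C * ‖h‖ ^ 2 := by
  obtain ⟨C, hC⟩ := exists_bound_iteratedDeriv_coherent (‖w‖ + 3) k n
  have hC0 : 0 ≤ C := (by positivity : (0 : ℝ) ≤ |0| ^ k * ‖iteratedDeriv n (coherent w) 0‖).trans
    (hC w (by linarith) 0)
  refine ⟨C, hC0, fun h hh => SchwartzMap.seminorm_le_bound' ℂ k n _ (by positivity) fun t => ?_⟩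
  have hcd : ∀ f : 𝓢(ℝ, ℂ), ContDiffAt ℝ n f t := fun f => (f.smooth n).contDiffAt
  have h1 : iteratedDeriv n (coherent (w + h) - coherent w - h • coherentDeriv w : 𝓢(ℝ, ℂ)) t =
      iteratedDeriv n (coherent (w + h)) t - iteratedDeriv n (coherent w) t -
        h * iteratedDeriv n (coherentDeriv w) t := by
    have h2 : ((coherent (w + h) - coherent w - h • coherentDeriv w : 𝓢(ℝ, ℂ)) : ℝ → ℂ) =
      (((coherent (w + h) : 𝓢(ℝ, ℂ)) : ℝ → ℂ) - coherent w) - fun t => h * coherentDeriv w t := by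
      ext t; simp
    have h3 : ContDiffAt ℝ n
        (((coherent (w + h) : 𝓢(ℝ, ℂ)) : ℝ → ℂ) - (coherent w : ℝ → ℂ)) t :=
      (hcd _).sub (hcd _)
    rw [h2, iteratedDeriv_sub h3 (contDiffAt_const.mul (hcd _)),
      iteratedDeriv_sub (hcd _) (hcd _), iteratedDeriv_const_mul_field]
  have h3 : ∀ v, HasDerivAt (fun v => ((|t| : ℝ) : ℂ) ^ k * iteratedDeriv n (coherent v) t)
      (((|t| : ℝ) : ℂ) ^ k * iteratedDeriv n (coherentDeriv v) t) v :=
    fun v => (hasDerivAt_iteratedDeriv_coherent v n t).const_mul _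
  have h4 := norm_taylor_remainder_le (w := w) (C := C) (fun v => (h3 v).differentiableAt)
    (fun v hv => by
      have h5 := hC v (by
        calc ‖v‖ = ‖w + (v - w)‖ := by ring_nf
          _ ≤ ‖w‖ + ‖v - w‖ := norm_add_le _ _
          _ ≤ ‖w‖ + 3 := by gcongr) t
      simpa using h5) hh
  rw [(h3 w).deriv] at h4
  rw [h1]
  refine le_trans (le_of_eq ?_) h4
  rw [show ((|t| : ℝ) : ℂ) ^ k * iteratedDeriv n (coherent (w + h)) t -
    ((|t| : ℝ) : ℂ) ^ k * iteratedDeriv n (coherent w) t -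
    h * (((|t| : ℝ) : ℂ) ^ k * iteratedDeriv n (coherentDeriv w) t) = ((|t| : ℝ) : ℂ) ^ k *
    (iteratedDeriv n (coherent (w + h)) t - iteratedDeriv n (coherent w) t -
      h * iteratedDeriv n (coherentDeriv w) t) by ring, norm_mul, norm_pow]
  simp

/-- The Bargmann transform of a tempered distribution is an entire function. -/
theorem hasDerivAt_bargmann (y : 𝓢'(ℝ, ℂ)) (w : ℂ) :
    HasDerivAt (fun w => y (coherent w)) (y (coherentDeriv w)) w := by
  obtain ⟨s, B, -, hB⟩ := Seminorm.bound_of_continuous (schwartz_withSeminorms ℂ ℝ ℂ)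
    ((normSeminorm ℂ ℂ).comp (y : 𝓢(ℝ, ℂ) →ₗ[ℂ] ℂ)) (continuous_norm.comp (map_continuous y))
  choose C hC0 hC using exists_seminorm_remainder_le w
  have key : ∀ h : ℂ, ‖h‖ ≤ 1 →
      ‖y (coherent (w + h)) - y (coherent w) - h • y (coherentDeriv w)‖ ≤
        B * (∑ i ∈ s, C i.1 i.2) * ‖h‖ ^ 2 := fun h hh => by
    have h1 := hB (coherent (w + h) - coherent w - h • coherentDeriv w)
    have h2 : (s.sup (schwartzSeminormFamily ℂ ℝ ℂ))
        (coherent (w + h) - coherent w - h • coherentDeriv w) ≤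
          (∑ i ∈ s, C i.1 i.2) * ‖h‖ ^ 2 := by
      refine Seminorm.finset_sup_apply_le
        (mul_nonneg (Finset.sum_nonneg fun i _ => hC0 _ _) (by positivity)) fun i hi => ?_
      refine (hC i.1 i.2 h hh).trans ?_
      gcongr
      exact Finset.single_le_sum (f := fun i => C i.1 i.2) (fun i _ => hC0 i.1 i.2) hi
    have h3 : ‖y (coherent (w + h) - coherent w - h • coherentDeriv w)‖ ≤
        B * (s.sup (schwartzSeminormFamily ℂ ℝ ℂ))
          (coherent (w + h) - coherent w - h • coherentDeriv w) := h1
    rw [map_sub, map_sub, map_smul] at h3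
    refine h3.trans ?_
    rw [mul_assoc]
    gcongr
  rw [hasDerivAt_iff_isLittleO_nhds_zero]
  refine Asymptotics.IsBigO.trans_isLittleO (g := fun h : ℂ => h ^ 2) ?_ ?_
  · refine Asymptotics.IsBigO.of_bound (B * ∑ i ∈ s, C i.1 i.2) ?_
    filter_upwards [Metric.closedBall_mem_nhds (0 : ℂ) one_pos] with h hh
    rw [norm_pow]
    exact key h (by simpa using hh)
  · simpa using Asymptotics.isLittleO_pow_id (𝕜 := ℂ) one_lt_two

end NoisySpectrogram

namespace NoisySpectrogram

open Polynomial ComplexConjugate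

/-! ### Gaussian moments of polynomials -/

theorem ofReal_two_rpow_quarter_sq :
    (((2 : ℝ) ^ (1 / 4 : ℝ) : ℝ) : ℂ) * (((2 : ℝ) ^ (1 / 4 : ℝ) : ℝ) : ℂ) = ((√2 : ℝ) : ℂ) := by
  rw [← Complex.ofReal_mul, ← Real.rpow_add two_pos, Real.sqrt_eq_rpow]
  norm_num

theorem coherent_zero_apply (t : ℝ) : coherent 0 t = gaussWindow t := by
  rw [coherent_apply, gaussWindow]
  simp

theorem coherent_mul_coherent_zero (w : ℂ) (t : ℝ) :
    coherent w t * coherent 0 t =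
      (√2 : ℝ) * Complex.exp (-2 * Real.pi * t ^ 2 + 2 * Real.pi * w * t +
        -(Real.pi * w ^ 2 / 2)) := by
  rw [coherent_apply, coherent_apply, mul_mul_mul_comm, ofReal_two_rpow_quarter_sq,
    ← Complex.exp_add]
  ring_nf

theorem coherent_mul_conj (w v : ℂ) (t : ℝ) :
    coherent w t * conj (coherent v t) =
      Complex.exp (Real.pi * (w * conj v)) * (coherent (w + conj v) t * coherent 0 t) := by
  rw [coherent_mul_coherent_zero, coherent_apply, coherent_apply, map_mul, Complex.conj_ofReal,
    mul_mul_mul_comm, ofReal_two_rpow_quarter_sq, ← Complex.exp_conj, ← Complex.exp_add,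
    mul_left_comm, ← Complex.exp_add]
  simp only [map_sub, map_add, map_mul, map_neg, map_pow, map_div₀, Complex.conj_ofReal,
    map_ofNat]
  ring_nf

theorem integrable_polynomial_mul_coherent (Q : ℂ[X]) (w : ℂ) :
    Integrable fun t : ℝ => Q.eval (t : ℂ) * (coherent w t * coherent 0 t) := by
  have h : ∃ M : ℝ, ∀ t : ℝ, ‖Q.eval (t : ℂ) * coherent w t‖ ≤ M := by
    choose M hM using fun k => exists_bound_iteratedDeriv_coherent ‖w‖ k 0
    refine ⟨∑ i ∈ Q.support, ‖Q.coeff i‖ * M i, fun t => ?_⟩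
    rw [eval_eq_sum, Polynomial.sum, Finset.sum_mul]
    refine (norm_sum_le _ _).trans (Finset.sum_le_sum fun i _ => ?_)
    have h1 := hM i w le_rfl t
    rw [iteratedDeriv_zero] at h1
    rw [norm_mul, norm_mul, norm_pow, Complex.norm_real, Real.norm_eq_abs, mul_assoc]
    gcongr
  obtain ⟨M, hM⟩ := h
  have h2 : AEStronglyMeasurable (fun t : ℝ => Q.eval (t : ℂ) * coherent w t) volume :=
    Continuous.aestronglyMeasurable
      ((Q.continuous.comp Complex.continuous_ofReal).mul (coherent w).continuous)
  simpa [mul_assoc] using (coherent 0).integrable.bdd_mul h2 (Filter.Eventually.of_forall hM)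

/-- The linear functional `Q ↦ ∫ Q(t) √2 exp(-2π(t - w/2)²) dt` on polynomials. For complex `w` this
is a Gaussian average around the complex point `w/2`. -/
noncomputable def gaussMoment (w : ℂ) : ℂ[X] →ₗ[ℂ] ℂ where
  toFun Q := ∫ t : ℝ, Q.eval (t : ℂ) * (coherent w t * coherent 0 t)
  map_add' P Q := by
    simp only [eval_add, add_mul]
    exact integral_add (integrable_polynomial_mul_coherent P w)
      (integrable_polynomial_mul_coherent Q w)
  map_smul' c Q := by
    simp only [eval_smul, smul_eq_mul, mul_assoc, RingHom.id_apply]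
    exact integral_const_mul _ _

theorem gaussMoment_apply (w : ℂ) (Q : ℂ[X]) :
    gaussMoment w Q = ∫ t : ℝ, Q.eval (t : ℂ) * (coherent w t * coherent 0 t) := rfl

theorem gaussMoment_one (w : ℂ) : gaussMoment w 1 = 1 := by
  have hb : (-2 * Real.pi : ℂ).re < 0 := by
    have : (-2 * Real.pi : ℂ).re = -(2 * Real.pi) := by simp
    rw [this]
    have := Real.pi_pos
    linarith
  have hpi : (Real.pi : ℂ) ≠ 0 := by exact_mod_cast Real.pi_ne_zero
  simp_rw [gaussMoment_apply, eval_one, one_mul, coherent_mul_coherent_zero]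
  rw [integral_const_mul, integral_cexp_quadratic hb]
  have h1 : -(Real.pi * w ^ 2 / 2) - (2 * Real.pi * w) ^ 2 / (4 * (-2 * Real.pi)) = (0 : ℂ) := by
    field_simp
    ring
  have h2 : (Real.pi / -(-2 * Real.pi) : ℂ) = ((1 / 2 : ℝ) : ℂ) := by
    push_cast
    field_simp
  rw [h1, Complex.exp_zero, mul_one, h2,
    show (1 / 2 : ℂ) = ((1 / 2 : ℝ) : ℂ) by push_cast; rfl,
    ← Complex.ofReal_cpow (by norm_num), ← Real.sqrt_eq_rpow, ← Complex.ofReal_mul,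
    ← Real.sqrt_mul (by norm_num)]
  norm_num

/-- Integration by parts against the Gaussian weight. -/
theorem gaussMoment_X_mul (w : ℂ) (Q : ℂ[X]) :
    gaussMoment w (X * Q) =
      w / 2 * gaussMoment w Q + 1 / (4 * Real.pi) * gaussMoment w (derivative Q) := by
  have hpi : (Real.pi : ℂ) ≠ 0 := by exact_mod_cast Real.pi_ne_zero
  set R : ℂ[X] := derivative Q - (4 * Real.pi : ℂ) • (X * Q) + (2 * Real.pi * w : ℂ) • Q with hR
  have h1 : ∀ t : ℝ, HasDerivAt (fun t : ℝ => Q.eval (t : ℂ) * (coherent w t * coherent 0 t))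
      (R.eval (t : ℂ) * (coherent w t * coherent 0 t)) t := fun t => by
    have h2 : HasDerivAt (fun t : ℝ => Q.eval (t : ℂ)) ((derivative Q).eval (t : ℂ)) t := by
      simpa using hasDerivAt_polynomial_sub Q 0 t
    refine (h2.fun_mul ((hasDerivAt_coherent w t).fun_mul (hasDerivAt_coherent 0 t))).congr_deriv ?_
    simp only [hR, eval_add, eval_sub, eval_smul, eval_mul, eval_X, smul_eq_mul]
    ring
  have h2 := integral_eq_zero_of_hasDerivAt_of_integrable h1
    (integrable_polynomial_mul_coherent R w) (integrable_polynomial_mul_coherent Q w)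
  rw [← gaussMoment_apply, hR, map_add, map_sub, map_smul, map_smul, smul_eq_mul, smul_eq_mul] at h2
  field_simp
  linear_combination -2 * h2

/-- The integration by parts formula and the total mass determine the Gaussian moments. -/
theorem linearMap_polynomial_ext_of_X_mul {L M : ℂ[X] →ₗ[ℂ] ℂ} {a b : ℂ}
    (hL : ∀ Q, L (X * Q) = a * L Q + b * L (derivative Q))
    (hM : ∀ Q, M (X * Q) = a * M Q + b * M (derivative Q)) (h1 : L 1 = M 1) : L = M := by
  have key : ∀ n, L (X ^ n) = M (X ^ n) := fun n => by
    induction n using Nat.strong_induction_on with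
    | _ n ih =>
      rcases n with _ | n
      · simpa using h1
      · have h2 : L (derivative (X ^ n)) = M (derivative (X ^ n)) := by
          rcases n with _ | n
          · simp
          · rw [derivative_X_pow, ← smul_eq_C_mul, map_smul, map_smul, Nat.add_sub_cancel,
              ih n (by omega)]
        rw [pow_succ', hL, hM, ih n (by omega), h2]
  ext n
  simpa [monomial_one_right_eq_X_pow] using key n

theorem gaussMoment_eq_comp (w : ℂ) (Q : ℂ[X]) :
    gaussMoment w Q = gaussMoment 0 (Q.comp (X + C (w / 2))) := by
  have h := linearMap_polynomial_ext_of_X_mul (L := gaussMoment w)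
    (M := (gaussMoment 0).comp (taylor (w / 2))) (gaussMoment_X_mul w) (fun Q => by
      simp only [LinearMap.comp_apply, taylor_apply, mul_comp, X_comp, add_mul, map_add,
        gaussMoment_X_mul, ← smul_eq_C_mul, map_smul, smul_eq_mul, derivative_comp]
      simp
      ring) (by simp [gaussMoment_one])
  rw [h, LinearMap.comp_apply, taylor_apply]

/-! ### Inner products of coherent states -/

theorem integral_polynomial_mul_coherent_mul_conj (Q : ℂ[X]) (w v : ℂ) :
    ∫ t : ℝ, Q.eval (t : ℂ) * (coherent w t * conj (coherent v t)) =
      Complex.exp (Real.pi * (w * conj v)) * gaussMoment (w + conj v) Q := by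
  rw [gaussMoment_apply, ← integral_const_mul]
  refine integral_congr_ae (Filter.Eventually.of_forall fun t => ?_)
  simp only [coherent_mul_conj]
  ring

/-- The coherent states reproduce the Bargmann kernel. -/
theorem integral_coherent_mul_conj (w v : ℂ) :
    ∫ t : ℝ, coherent w t * conj (coherent v t) = Complex.exp (Real.pi * (w * conj v)) := by
  simpa [gaussMoment_one] using integral_polynomial_mul_coherent_mul_conj 1 w v

theorem integral_coherentDeriv_mul_conj (w v : ℂ) :
    ∫ t : ℝ, coherentDeriv w t * conj (coherent v t) =
      Real.pi * conj v * Complex.exp (Real.pi * (w * conj v)) := by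
  have h := integral_polynomial_mul_coherent_mul_conj
    ((2 * Real.pi : ℂ) • (X * 1) - (Real.pi * w : ℂ) • 1) w v
  rw [map_sub, map_smul, map_smul, gaussMoment_X_mul, gaussMoment_one] at h
  simp only [coherentDeriv_apply, mul_assoc]
  simp only [eval_sub, eval_smul, eval_X, eval_one, smul_eq_mul, mul_one,
    derivative_one, map_zero, mul_zero, add_zero, mul_assoc] at h
  rw [h]
  ring

theorem integral_coherentDeriv_mul_conj_self (w : ℂ) :
    ∫ t : ℝ, coherentDeriv w t * conj (coherentDeriv w t) =
      Real.pi * (1 + Real.pi * (w * conj w)) * Complex.exp (Real.pi * (w * conj w)) := by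
  have hpi : (Real.pi : ℂ) ≠ 0 := by exact_mod_cast Real.pi_ne_zero
  have h := integral_polynomial_mul_coherent_mul_conj
    ((4 * Real.pi ^ 2 : ℂ) • (X * (X * 1)) - (2 * Real.pi ^ 2 * (w + conj w) : ℂ) • (X * 1) +
      (Real.pi ^ 2 * (w * conj w) : ℂ) • 1) w w
  rw [map_add, map_sub, map_smul, map_smul, map_smul, gaussMoment_X_mul, gaussMoment_X_mul,
    gaussMoment_one] at h
  simp only [mul_one, derivative_X, derivative_one, map_zero, mul_zero, add_zero, smul_eq_mul,
    gaussMoment_one, eval_add, eval_sub, eval_smul, eval_mul, eval_X, eval_one] at h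
  have h2 : ∀ t : ℝ, coherentDeriv w t * conj (coherentDeriv w t) =
      (4 * Real.pi ^ 2 * ((t : ℂ) * t) - 2 * Real.pi ^ 2 * (w + conj w) * t +
        Real.pi ^ 2 * (w * conj w)) * (coherent w t * conj (coherent w t)) := fun t => by
    rw [coherentDeriv_apply]
    simp only [map_sub, map_mul, Complex.conj_ofReal, map_ofNat]
    ring
  simp_rw [h2]
  rw [h]
  field_simp
  ring

/-! ### The Bargmann transform of a Hermite function -/

theorem comp_X_add_C_eq_sum_hasseDeriv (P : ℂ[X]) (r : ℂ) {n : ℕ} (hn : P.natDegree ≤ n) :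
    P.comp (X + C r) = ∑ j ∈ Finset.range (n + 1), r ^ j • hasseDeriv j P := by
  conv_lhs => rw [P.as_sum_range' (n + 1) (by omega)]
  simp_rw [Polynomial.sum_comp]
  conv_rhs =>
    enter [2, j, 2]
    rw [P.as_sum_range' (n + 1) (by omega)]
  simp_rw [map_sum, Finset.smul_sum]
  rw [Finset.sum_comm]
  refine Finset.sum_congr rfl fun i hi => ?_
  rw [monomial_comp, add_comm X, add_pow, Finset.mul_sum]
  have hi' : i + 1 ≤ n + 1 := Finset.mem_range.1 hi
  rw [← Finset.sum_subset (Finset.range_subset_range.2 hi') fun j _ hj => ?_]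
  · refine Finset.sum_congr rfl fun j _ => ?_
    rw [hasseDeriv_monomial, ← C_mul_X_pow_eq_monomial, smul_eq_C_mul]
    simp only [map_mul, map_pow, map_natCast]
    ring
  · rw [hasseDeriv_monomial, Nat.choose_eq_zero_of_lt (by simpa using hj)]
    simp

/-- The formal adjoint of differentiation for the weight `exp(-2πt²)`. -/
noncomputable def weightedAdjoint (Q : ℂ[X]) : ℂ[X] := C (4 * Real.pi : ℂ) * (X * Q) - derivative Q

theorem gaussMoment_iterate_derivative_mul (j : ℕ) (P R : ℂ[X]) :
    gaussMoment 0 (derivative^[j] P * R) = gaussMoment 0 (P * weightedAdjoint^[j] R) := by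
  have hpi : (Real.pi : ℂ) ≠ 0 := by exact_mod_cast Real.pi_ne_zero
  induction j generalizing P R with
  | zero => rfl
  | succ j ih =>
    rw [Function.iterate_succ_apply', Function.iterate_succ_apply, ← ih]
    set S := derivative^[j] P
    have h := gaussMoment_X_mul 0 (S * R)
    rw [derivative_mul, map_add] at h
    have h2 : S * weightedAdjoint R = (4 * Real.pi : ℂ) • (X * (S * R)) - S * derivative R := by
      rw [weightedAdjoint, smul_eq_C_mul]
      ring
    rw [h2, map_sub, map_smul, h, smul_eq_mul]
    field_simp
    ring

theorem weightedAdjoint_iterate_one (j : ℕ) :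
    (weightedAdjoint^[j] 1).natDegree ≤ j ∧
      (weightedAdjoint^[j] 1).coeff j = (4 * Real.pi : ℂ) ^ j := by
  induction j with
  | zero => simp
  | succ j ih =>
    rw [Function.iterate_succ_apply']
    set S := weightedAdjoint^[j] 1
    have h1 : (derivative S).natDegree ≤ j := (natDegree_derivative_le S).trans (by omega)
    constructor
    · refine (natDegree_sub_le _ _).trans (max_le ?_ (by omega))
      refine (natDegree_C_mul_le _ _).trans (natDegree_mul_le.trans ?_)
      rw [natDegree_X]
      omega
    · rw [weightedAdjoint, coeff_sub, coeff_C_mul, coeff_X_mul, ih.2,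
        coeff_eq_zero_of_natDegree_lt (by omega), sub_zero, pow_succ']

variable {k : ℕ} {H : ℝ[X]}

theorem IsOrthogonalPolynomial.gaussMoment_mul (hH : IsOrthogonalPolynomial k H) {q : ℂ[X]}
    (hq : q.natDegree ≤ k) :
    gaussMoment 0 (H.map Complex.ofRealHom * q) =
      q.coeff k * gaussMoment 0 (H.map Complex.ofRealHom * X ^ k) := by
  conv_lhs => rw [q.as_sum_range' (k + 1) (by omega)]
  rw [Finset.mul_sum, map_sum, Finset.sum_range_succ, Finset.sum_eq_zero fun i hi => ?_, zero_add]
  · rw [← C_mul_X_pow_eq_monomial, mul_left_comm, ← smul_eq_C_mul, map_smul, smul_eq_mul]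
  · rw [← C_mul_X_pow_eq_monomial, mul_left_comm, ← smul_eq_C_mul, map_smul, smul_eq_mul]
    have h := hH.2 (X ^ i) (by
      rw [degree_X_pow]
      exact_mod_cast Finset.mem_range.1 hi)
    have h2 : gaussMoment 0 (H.map Complex.ofRealHom * X ^ i) =
        ((√2 * ∫ t : ℝ, H.eval t * (X ^ i : ℝ[X]).eval t * Real.exp (-2 * Real.pi * t ^ 2) : ℝ) : ℂ)
        := by
      rw [gaussMoment_apply, ← integral_const_mul, ← integral_complex_ofReal]
      refine integral_congr_ae (Filter.Eventually.of_forall fun t => ?_)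
      simp only [coherent_mul_coherent_zero, eval_mul, eval_pow, eval_X,
        ← Complex.ofRealHom_eq_coe, eval_map, eval₂_at_apply]
      simp only [Complex.ofRealHom_eq_coe]
      push_cast
      simp
      ring
    rw [h2, h]
    simp

theorem IsOrthogonalPolynomial.natDegree_map (hH : IsOrthogonalPolynomial k H) :
    (H.map Complex.ofRealHom).natDegree = k := by
  rw [Polynomial.natDegree_map]
  exact natDegree_eq_of_degree_eq_some hH.1

theorem IsOrthogonalPolynomial.gaussMoment_hasseDeriv (hH : IsOrthogonalPolynomial k H) {j : ℕ}
    (hj : j ≤ k) :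
    (j.factorial : ℂ) * gaussMoment 0 (hasseDeriv j (H.map Complex.ofRealHom)) =
      (weightedAdjoint^[j] 1).coeff k * gaussMoment 0 (H.map Complex.ofRealHom * X ^ k) := by
  rw [← hH.gaussMoment_mul ((weightedAdjoint_iterate_one j).1.trans hj),
    ← gaussMoment_iterate_derivative_mul, mul_one, ← factorial_smul_hasseDeriv,
    LinearMap.smul_apply, map_nsmul, nsmul_eq_mul]

/-- The Gaussian average of an orthogonal polynomial around `w / 2` is a monomial in `w`. -/
theorem IsOrthogonalPolynomial.gaussMoment_eq (hH : IsOrthogonalPolynomial k H) (w : ℂ) :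
    gaussMoment w (H.map Complex.ofRealHom) =
      (2 * Real.pi * w) ^ k / k.factorial * gaussMoment 0 (H.map Complex.ofRealHom * X ^ k) := by
  have hk : (k.factorial : ℂ) ≠ 0 := by exact_mod_cast k.factorial_ne_zero
  rw [gaussMoment_eq_comp, comp_X_add_C_eq_sum_hasseDeriv _ _ hH.natDegree_map.le, map_sum,
    Finset.sum_range_succ, Finset.sum_eq_zero fun j hj => ?_, zero_add, map_smul, smul_eq_mul]
  · have h := hH.gaussMoment_hasseDeriv le_rfl
    rw [(weightedAdjoint_iterate_one k).2] at h
    have h2 : (w / 2) ^ k * (4 * Real.pi : ℂ) ^ k = (2 * Real.pi * w) ^ k := by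
      rw [← mul_pow]
      ring
    rw [← h2]
    field_simp
    linear_combination (w / 2) ^ k * h
  · have hjk : j < k := Finset.mem_range.1 hj
    have h := hH.gaussMoment_hasseDeriv hjk.le
    have hj' : (j.factorial : ℂ) ≠ 0 := by exact_mod_cast j.factorial_ne_zero
    rw [coeff_eq_zero_of_natDegree_lt ((weightedAdjoint_iterate_one j).1.trans_lt hjk), zero_mul,
      mul_eq_zero_iff_left hj'] at h
    rw [map_smul, h, smul_zero]

/-- The squared norm of an orthogonal polynomial in terms of its `k`-th moment. -/
theorem IsOrthogonalPolynomial.gaussMoment_sq (hH : IsOrthogonalPolynomial k H) :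
    gaussMoment 0 (H.map Complex.ofRealHom * H.map Complex.ofRealHom) =
      (4 * Real.pi) ^ k / k.factorial * gaussMoment 0 (H.map Complex.ofRealHom * X ^ k) ^ 2 := by
  have hk : (k.factorial : ℂ) ≠ 0 := by exact_mod_cast k.factorial_ne_zero
  have h := hH.gaussMoment_hasseDeriv le_rfl
  have h2 : hasseDeriv k (H.map Complex.ofRealHom) = C ((H.map Complex.ofRealHom).coeff k) := by
    ext n
    rw [hasseDeriv_coeff, coeff_C]
    rcases n with _ | n
    · simp
    · rw [coeff_eq_zero_of_natDegree_lt (by rw [hH.natDegree_map]; omega)]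
      simp
  rw [(weightedAdjoint_iterate_one k).2, h2, ← mul_one (C _), ← smul_eq_C_mul, map_smul,
    gaussMoment_one, smul_eq_mul, mul_one] at h
  rw [hH.gaussMoment_mul hH.natDegree_map.le]
  field_simp
  linear_combination gaussMoment 0 (H.map Complex.ofRealHom * X ^ k) * h

/-- The Bargmann transform of the `k`-th Hermite function is, up to a phase, the normalized
monomial `√(π^k / k!) w^k`. -/
theorem IsHermiteFunction.exists_bargmann_eq {h : Lp ℂ 2 (volume : Measure ℝ)}
    (hh : IsHermiteFunction k h) :
    ∃ κ : ℂ, ‖κ‖ ^ 2 = Real.pi ^ k / k.factorial ∧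
      ∀ w : ℂ, (h : 𝓢'(ℝ, ℂ)) (coherent w) = κ * w ^ k := by
  obtain ⟨hnorm, H, hH, c, hc⟩ := hh
  set P := H.map Complex.ofRealHom with hP
  have hPe : ∀ t : ℝ, P.eval (t : ℂ) = H.eval t := fun t => by
    rw [hP, eval_map, ← Complex.ofRealHom_eq_coe, eval₂_at_apply]
    rfl
  have hk : (k.factorial : ℂ) ≠ 0 := by exact_mod_cast k.factorial_ne_zero
  have hN : (1 : ℂ) = ((‖c‖ ^ 2 : ℝ) : ℂ) * gaussMoment 0 (P * P) := by
    have h1 : inner ℂ h h = (1 : ℂ) := by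
      rw [inner_self_eq_norm_sq_to_K, hnorm]
      simp
    rw [← h1, L2.inner_def, gaussMoment_apply, ← integral_const_mul]
    refine integral_congr_ae ?_
    filter_upwards [hc] with t ht
    have h2 : inner ℂ (c * ((H.eval t * gaussWindow t : ℝ) : ℂ))
        (c * ((H.eval t * gaussWindow t : ℝ) : ℂ)) =
        c * conj c * ((H.eval t * gaussWindow t : ℝ) : ℂ) ^ 2 := by
      simp only [RCLike.inner_apply, map_mul, Complex.conj_ofReal]
      ring
    rw [ht, eval_mul, hPe, coherent_zero_apply, h2, Complex.mul_conj, Complex.normSq_eq_norm_sq]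
    push_cast
    ring
  refine ⟨c * ((2 * Real.pi) ^ k / k.factorial * gaussMoment 0 (P * X ^ k)), ?_, fun w => ?_⟩
  · rw [hH.gaussMoment_sq] at hN
    have h3 := congrArg norm hN
    simp only [norm_mul, norm_div, norm_pow, Complex.norm_real, norm_one, Complex.norm_natCast,
      Complex.norm_ofNat, norm_norm, Real.norm_of_nonneg Real.pi_pos.le] at h3 ⊢
    have hk' : (k.factorial : ℝ) ≠ 0 := by exact_mod_cast k.factorial_ne_zero
    have h4 : ((2 * Real.pi) ^ k) ^ 2 = (4 * Real.pi) ^ k * Real.pi ^ k := by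
      rw [← pow_mul, mul_comm k, pow_mul, ← mul_pow]
      ring
    calc (‖c‖ * ((2 * Real.pi) ^ k / k.factorial * ‖gaussMoment 0 (P * X ^ k)‖)) ^ 2
        = Real.pi ^ k / k.factorial * (‖c‖ ^ 2 * ((4 * Real.pi) ^ k / k.factorial *
          ‖gaussMoment 0 (P * X ^ k)‖ ^ 2)) := by
          rw [mul_pow, mul_pow, div_pow, h4]
          field_simp
      _ = _ := by rw [← h3, mul_one]
  · rw [Lp.toTemperedDistribution_apply]
    have h3 : ∫ t : ℝ, coherent w t • h t = c * gaussMoment w P := by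
      rw [gaussMoment_apply, ← integral_const_mul]
      refine integral_congr_ae ?_
      filter_upwards [hc] with t ht
      rw [ht, hPe, coherent_zero_apply, smul_eq_mul]
      push_cast
      ring
    rw [h3, hH.gaussMoment_eq]
    ring

end NoisySpectrogram

namespace NoisySpectrogram

open Set Metric Filter Topology

/-! ### Counting zeros from countably many values -/

theorem exists_zero_iff_of_isCompact {f : ℂ → ℂ} (hf : Continuous f) {K : Set ℂ} (hK : IsCompact K)
    {d : ℕ → ℂ} (hd : DenseRange d) :
    (∃ z ∈ K, f z = 0) ↔ ∀ n : ℕ, ∃ i, (∃ q ∈ K, dist (d i) q < 1 / ((n : ℝ) + 1)) ∧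
      ‖f (d i)‖ < 1 / ((n : ℝ) + 1) := by
  constructor
  · rintro ⟨z, hz, hfz⟩ n
    have hn : (0 : ℝ) < 1 / ((n : ℝ) + 1) := Nat.one_div_pos_of_nat
    have ho : IsOpen ({x | dist x z < 1 / ((n : ℝ) + 1)} ∩ {x | ‖f x‖ < 1 / ((n : ℝ) + 1)}) :=
      (isOpen_lt (by fun_prop) (by fun_prop)).inter (isOpen_lt (by fun_prop) (by fun_prop))
    obtain ⟨i, hi⟩ := hd.exists_mem_open ho ⟨z, by simpa using hn, by simpa [hfz] using hn⟩
    exact ⟨i, ⟨z, hz, hi.1⟩, hi.2⟩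
  · intro h
    choose i hq hi using h
    choose q hqK hq using hq
    obtain ⟨z, hz, φ, hφ, hlim⟩ := hK.tendsto_subseq hqK
    refine ⟨z, hz, ?_⟩
    have h0 : Tendsto (fun n => 1 / ((φ n : ℝ) + 1)) atTop (𝓝 0) :=
      (tendsto_one_div_add_atTop_nhds_zero_nat (𝕜 := ℝ)).comp hφ.tendsto_atTop
    have h1 : Tendsto (fun n => dist (d (i (φ n))) (q (φ n))) atTop (𝓝 0) :=
      squeeze_zero (fun _ => dist_nonneg) (fun n => (hq (φ n)).le) h0
    have h2 : Tendsto (fun n => d (i (φ n))) atTop (𝓝 z) := by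
      rw [tendsto_iff_dist_tendsto_zero] at hlim ⊢
      refine squeeze_zero (fun _ => dist_nonneg)
        (fun n => dist_triangle _ (q (φ n)) _) ?_
      simpa using h1.add hlim
    have h3 : Tendsto (fun n => f (d (i (φ n)))) atTop (𝓝 0) :=
      squeeze_zero_norm (fun n => (hi (φ n)).le) h0
    exact tendsto_nhds_unique ((hf.tendsto z).comp h2) h3

open Classical in
/-- The number of zeros in a compact set is the largest number of disjoint balls, from a countable
family, that each contain one. -/
theorem count_inter_zeros_eq_iSup (f : ℂ → ℂ) {K : Set ℂ}
    (hfin : (K ∩ f ⁻¹' {0}).Finite) {d : ℕ → ℂ} (hd : DenseRange d) :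
    Measure.count (K ∩ f ⁻¹' {0}) =
      ⨆ (s : Finset (ℕ × ℕ)) (_ : (s : Set (ℕ × ℕ)).PairwiseDisjoint
        fun p => closedBall (d p.1) (1 / ((p.2 : ℝ) + 1))),
        if ∀ p ∈ s, ∃ z ∈ K ∩ closedBall (d p.1) (1 / ((p.2 : ℝ) + 1)), f z = 0
          then (s.card : ℝ≥0∞) else 0 := by
  rw [Measure.count_apply_finite _ hfin]
  apply le_antisymm
  · obtain ⟨U, hU, hdisj⟩ := hfin.t2_separation
    have h1 : ∀ z : ℂ, ∃ p : ℕ × ℕ, z ∈ closedBall (d p.1) (1 / ((p.2 : ℝ) + 1)) ∧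
        closedBall (d p.1) (1 / ((p.2 : ℝ) + 1)) ⊆ U z := fun z => by
      obtain ⟨ε, hε, hball⟩ := Metric.isOpen_iff.1 (hU z).2 z (hU z).1
      obtain ⟨n, hn⟩ := exists_nat_one_div_lt (half_pos hε)
      obtain ⟨i, hi⟩ := hd.exists_dist_lt z (ε := 1 / ((n : ℝ) + 1)) Nat.one_div_pos_of_nat
      refine ⟨(i, n), hi.le, fun x hx => hball ?_⟩
      rw [mem_closedBall] at hx
      rw [mem_ball]
      calc dist x z ≤ dist x (d i) + dist z (d i) := dist_triangle_right _ _ _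
        _ < ε := by dsimp only at hx; linarith
    choose p hp hpU using h1
    have hinj : Set.InjOn p (hfin.toFinset : Set ℂ) := fun z hz w hw h => by
      by_contra hne
      have h2 := hdisj (by simpa using hz) (by simpa using hw) hne
      exact Set.disjoint_left.1 h2 (hpU z (hp z)) (hpU w (h ▸ hp z))
    refine le_iSup₂_of_le (hfin.toFinset.image p) ?_ ?_
    · intro a ha b hb hab
      simp only [Finset.coe_image, Set.mem_image, Finset.mem_coe, Finite.mem_toFinset] at ha hb
      obtain ⟨z, hz, rfl⟩ := ha
      obtain ⟨w, hw, rfl⟩ := hb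
      exact (hdisj hz hw (fun h => hab (h ▸ rfl))).mono (hpU z) (hpU w)
    · rw [if_pos, Finset.card_image_of_injOn hinj]
      intro a ha
      simp only [Finset.mem_image, Finite.mem_toFinset] at ha
      obtain ⟨z, hz, rfl⟩ := ha
      exact ⟨z, ⟨hz.1, hp z⟩, hz.2⟩
  · refine iSup₂_le fun s hs => ?_
    split_ifs with h
    · choose! z hz hfz using h
      have h2 : s.card ≤ hfin.toFinset.card := by
        refine Finset.card_le_card_of_injOn z (fun p hp => ?_) (fun p hp q hq hpq => ?_)
        · simp only [Finite.coe_toFinset]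
          exact ⟨(hz p hp).1, hfz p hp⟩
        · by_contra hne
          exact Set.disjoint_left.1 (hs hp hq hne) (hz p hp).2 (hpq ▸ (hz q hq).2)
      exact_mod_cast h2
    · exact zero_le

open Classical in
/-- The number of zeros of a continuous function in a Borel subset of a ball is a measurable function
of the values on a countable dense set, as long as there are finitely many zeros in the ball. -/
theorem exists_measurable_count_zeros {d : ℕ → ℂ} (hd : DenseRange d) (R : ℝ) {A : Set ℂ}
    (hA : MeasurableSet A) :
    ∃ Φ : (ℕ → ℂ) → ℝ≥0∞, Measurable Φ ∧ ∀ f : ℂ → ℂ, Continuous f →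
      (closedBall 0 R ∩ f ⁻¹' {0}).Finite →
        Φ (fun n => f (d n)) = Measure.count (A ∩ (closedBall 0 R ∩ f ⁻¹' {0})) := by
  have hcompact : ∀ K : Set ℂ, IsCompact K → ∃ Φ : (ℕ → ℂ) → ℝ≥0∞, Measurable Φ ∧
      ∀ f : ℂ → ℂ, Continuous f → (K ∩ f ⁻¹' {0}).Finite →
        Φ (fun n => f (d n)) = Measure.count (K ∩ f ⁻¹' {0}) := fun K hK => by
    refine ⟨fun x => ⨆ (s : Finset (ℕ × ℕ)) (_ : (s : Set (ℕ × ℕ)).PairwiseDisjoint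
        fun p => closedBall (d p.1) (1 / ((p.2 : ℝ) + 1))),
        if ∀ p ∈ s, ∀ n : ℕ, ∃ i, (∃ q ∈ K ∩ closedBall (d p.1) (1 / ((p.2 : ℝ) + 1)),
          dist (d i) q < 1 / ((n : ℝ) + 1)) ∧ ‖x i‖ < 1 / ((n : ℝ) + 1)
          then (s.card : ℝ≥0∞) else 0, ?_, fun f hf hfin => ?_⟩
    · refine Measurable.iSup fun s => Measurable.iSup fun _ =>
        Measurable.ite ?_ measurable_const measurable_const
      have : {x : ℕ → ℂ | ∀ p ∈ s, ∀ n : ℕ, ∃ i,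
          (∃ q ∈ K ∩ closedBall (d p.1) (1 / ((p.2 : ℝ) + 1)),
          dist (d i) q < 1 / ((n : ℝ) + 1)) ∧ ‖x i‖ < 1 / ((n : ℝ) + 1)} =
        ⋂ p ∈ s, ⋂ n : ℕ, ⋃ i, ⋃ (_ : ∃ q ∈ K ∩ closedBall (d p.1) (1 / ((p.2 : ℝ) + 1)),
          dist (d i) q < 1 / ((n : ℝ) + 1)), {x | ‖x i‖ < 1 / ((n : ℝ) + 1)} := by
        ext x
        simp only [mem_ofPred_eq, mem_iInter, mem_iUnion, exists_prop]
      rw [this]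
      exact Finset.measurableSet_biInter _ fun p _ => MeasurableSet.iInter fun n =>
        MeasurableSet.iUnion fun i => MeasurableSet.iUnion fun _ =>
          measurableSet_lt (measurable_pi_apply i).norm measurable_const
    · rw [count_inter_zeros_eq_iSup f hfin hd]
      simp_rw [exists_zero_iff_of_isCompact hf (hK.inter_right isClosed_closedBall) hd]
  -- compact sets generate the Borel sets of the ball, and additivity does the rest
  have hZ : ∀ f : ℂ → ℂ, Continuous f → MeasurableSet (closedBall 0 R ∩ f ⁻¹' {0}) := fun f hf =>
    (isClosed_closedBall.inter (isClosed_singleton.preimage hf)).measurableSet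
  have hgen : (inferInstance : MeasurableSpace ℂ) =
      MeasurableSpace.generateFrom {s : Set ℂ | IsClosed s} :=
    BorelSpace.measurable_eq.trans borel_eq_generateFrom_isClosed
  induction A, hA using MeasurableSpace.induction_on_inter hgen isPiSystem_isClosed with
  | empty => exact ⟨0, measurable_const, fun f _ _ => by simp⟩
  | basic C hC =>
    obtain ⟨Φ, hΦ, h⟩ := hcompact (C ∩ closedBall 0 R)
      ((isCompact_closedBall 0 R).inter_left hC)
    refine ⟨Φ, hΦ, fun f hf hfin => ?_⟩
    rw [h f hf (hfin.subset fun z hz => ⟨hz.1.2, hz.2⟩), inter_assoc]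
  | compl A hA ih =>
    obtain ⟨Φ, hΦ, h⟩ := ih
    obtain ⟨Ψ, hΨ, h'⟩ := hcompact (closedBall 0 R) (isCompact_closedBall 0 R)
    refine ⟨fun x => Ψ x - Φ x, hΨ.sub hΦ, fun f hf hfin => ?_⟩
    have hlt : Measure.count (A ∩ (closedBall 0 R ∩ f ⁻¹' {0})) < ∞ :=
      Measure.count_apply_lt_top.2 (hfin.subset inter_subset_right)
    change Ψ _ - Φ _ = _
    rw [h f hf hfin, h' f hf hfin,
      ← measure_inter_add_sdiff (closedBall 0 R ∩ f ⁻¹' {0}) hA, inter_comm A,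
      ENNReal.add_sub_cancel_left (by rw [inter_comm]; exact hlt.ne), sdiff_eq, inter_comm Aᶜ]
  | iUnion A hdisj hA ih =>
    choose Φ hΦ h using ih
    refine ⟨fun x => ∑' n, Φ n x, Measurable.tsum hΦ, fun f hf hfin => ?_⟩
    rw [iUnion_inter, measure_iUnion
      (fun i j hij => (hdisj hij).mono inter_subset_left inter_subset_left)
      fun n => (hA n).inter (hZ f hf)]
    exact tsum_congr fun n => h n f hf hfin

end NoisySpectrogram

namespace NoisySpectrogram

open Set Metric Filter Topology

/-! ### The area formula for entire functions -/

theorem exists_approximatesLinearOn_injOn (A : ℂ →L[ℝ] ℂ) :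
    ∃ δ : ℝ≥0, δ ≠ 0 ∧ (A.det ≠ 0 → ∀ (s : Set ℂ) (f : ℂ → ℂ), ApproximatesLinearOn f A s δ →
      InjOn f s) := by
  by_cases hA : A.det = 0
  · exact ⟨1, one_ne_zero, fun h => absurd hA h⟩
  · set e := A.toContinuousLinearEquivOfDetNeZero hA
    have he : (e : ℂ →L[ℝ] ℂ) = A := ContinuousLinearMap.ext fun _ => rfl
    have hpos : 0 < ‖(e.symm : ℂ →L[ℝ] ℂ)‖₊⁻¹ := inv_pos.2 e.nnnorm_symm_pos
    refine ⟨‖(e.symm : ℂ →L[ℝ] ℂ)‖₊⁻¹ / 2, (half_pos hpos).ne', fun _ s f hf => ?_⟩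
    rw [← he] at hf
    exact hf.injOn (Or.inr (half_lt_self hpos))

/-- The derivative of a holomorphic function as a real linear map. -/
noncomputable def realDeriv (f : ℂ → ℂ) (z : ℂ) : ℂ →L[ℝ] ℂ :=
  (ContinuousLinearMap.toSpanSingleton ℂ (deriv f z)).restrictScalars ℝ

theorem det_realDeriv (f : ℂ → ℂ) (z : ℂ) : (realDeriv f z).det = ‖deriv f z‖ ^ 2 := by
  have h : ((ContinuousLinearMap.toSpanSingleton ℂ (deriv f z) : ℂ →L[ℂ] ℂ) : ℂ →ₗ[ℂ] ℂ).det =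
      deriv f z := by
    rw [LinearMap.det_ring]
    simp
  rw [realDeriv, ContinuousLinearMap.det, ContinuousLinearMap.coe_restrictScalars,
    LinearMap.det_restrictScalars, h, Algebra.norm_complex_apply, Complex.normSq_eq_norm_sq]

/-- The area formula for an entire function: the number of preimages in `A`, without multiplicity,
integrates to the integral of the Jacobian over `A`. -/
theorem lintegral_count_preimage_mul {f : ℂ → ℂ} (hf : Differentiable ℂ f) {A : Set ℂ}
    (hA : MeasurableSet A) {p : ℂ → ℝ≥0∞} (hp : Measurable p) :
    ∫⁻ a, Measure.count (A ∩ f ⁻¹' {a}) * p a =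
      ∫⁻ z in A, ENNReal.ofReal (‖deriv f z‖ ^ 2) * p (f z) := by
  have hd : ∀ s : Set ℂ, ∀ z ∈ s, HasFDerivWithinAt f (realDeriv f z) s z := fun s z _ =>
    ((hf z).hasDerivAt.hasFDerivAt.restrictScalars ℝ).hasFDerivWithinAt
  have hd' : Measurable (deriv f) := measurable_deriv f
  set N := A ∩ deriv f ⁻¹' {0}
  set S := A ∩ (deriv f ⁻¹' {0})ᶜ
  have hNm : MeasurableSet N := hA.inter (hd' (measurableSet_singleton 0))
  have hSm : MeasurableSet S := hA.inter (hd' (measurableSet_singleton 0)).compl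
  have hNS : N ∪ S = A := inter_union_compl A _
  have hdisjNS : Disjoint N S := disjoint_compl_right.mono inter_subset_right inter_subset_right
  have hN : volume (f '' N) = 0 :=
    addHaar_image_eq_zero_of_det_fderivWithin_eq_zero volume (hd N) fun z hz => by
      have h0 : deriv f z = 0 := hz.2
      rw [det_realDeriv, h0]
      simp
  choose δ hδ hinj using exists_approximatesLinearOn_injOn
  obtain ⟨t, B, htdisj, htm, hcov, happ, hB⟩ :=
    exists_partition_approximatesLinearOn_of_hasFDerivWithinAt f S (realDeriv f) (hd S) δ hδ
  have hinj' : ∀ n, InjOn f (S ∩ t n) := fun n => by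
    rcases S.eq_empty_or_nonempty with hS | hS
    · simp [hS]
    · obtain ⟨y, hy, hBy⟩ := hB hS n
      refine hinj (B n) ?_ _ _ (happ n)
      have h0 : deriv f y ≠ 0 := hy.2
      rw [hBy, det_realDeriv]
      simpa using h0
  have hSt : ∀ n, MeasurableSet (S ∩ t n) := fun n => hSm.inter (htm n)
  have hSU : S = ⋃ n, S ∩ t n := by rw [← inter_iUnion, inter_eq_left.2 hcov]
  have hdisjS : Pairwise (Function.onFun Disjoint fun n => S ∩ t n) := fun i j hij =>
    (htdisj hij).mono inter_subset_right inter_subset_right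
  have him : ∀ n, MeasurableSet (f '' (S ∩ t n)) := fun n =>
    measurable_image_of_fderivWithin (hSt n) (hd _) (hinj' n)
  have hpre : ∀ a, MeasurableSet (f ⁻¹' {a}) := fun a =>
    hf.continuous.measurable (measurableSet_singleton a)
  have hcount : ∀ n a, Measure.count (S ∩ t n ∩ f ⁻¹' {a}) =
      (f '' (S ∩ t n)).indicator 1 a := fun n a => by
    by_cases ha : a ∈ f '' (S ∩ t n)
    · obtain ⟨z, hz, rfl⟩ := ha
      rw [indicator_of_mem (mem_image_of_mem f hz), Pi.one_apply, ← Measure.count_singleton z]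
      congr 1
      ext w
      simp only [mem_inter_iff, mem_preimage, mem_singleton_iff]
      exact ⟨fun h => hinj' n h.1 hz h.2, by rintro rfl; exact ⟨hz, rfl⟩⟩
    · rw [indicator_of_notMem ha, Measure.count_eq_zero_iff, eq_empty_iff_forall_notMem]
      exact fun w hw => ha ⟨w, hw.1, hw.2⟩
  have hae : ∀ᵐ a, Measure.count (A ∩ f ⁻¹' {a}) * p a =
      ∑' n, (f '' (S ∩ t n)).indicator p a := by
    filter_upwards [measure_eq_zero_iff_ae_notMem.1 hN] with a ha
    have h1 : A ∩ f ⁻¹' {a} = ⋃ n, S ∩ t n ∩ f ⁻¹' {a} := by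
      rw [← iUnion_inter, ← hSU]
      ext z
      constructor
      · intro hz
        refine ⟨⟨hz.1, fun h0 => ha ⟨z, ⟨hz.1, h0⟩, hz.2⟩⟩, hz.2⟩
      · exact fun hz => ⟨hz.1.1, hz.2⟩
    rw [h1, measure_iUnion
      (fun i j hij => (hdisjS hij).mono inter_subset_left inter_subset_left)
      (fun n => (hSt n).inter (hpre a)), ← ENNReal.tsum_mul_right]
    refine tsum_congr fun n => ?_
    rw [hcount]
    by_cases ha : a ∈ f '' (S ∩ t n) <;> simp [ha]
  rw [lintegral_congr_ae hae, lintegral_tsum fun n => (hp.indicator (him n)).aemeasurable]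
  simp_rw [lintegral_indicator (him _), lintegral_image_eq_lintegral_abs_det_fderiv_mul volume
    (hSt _) (hd _) (hinj' _), det_realDeriv]
  rw [← lintegral_iUnion hSt hdisjS, ← hSU, ← hNS, lintegral_union hSm hdisjNS,
    setLIntegral_congr_fun (g := fun _ => 0) hNm fun z hz => ?_, lintegral_zero, zero_add]
  · simp
  · have h0 : deriv f z = 0 := hz.2
    simp [h0]

end NoisySpectrogram

namespace NoisySpectrogram

open Set Filter Topology ComplexConjugate

/-! ### White noise as a Gaussian process -/

/-- The inclusion of the Schwartz space in `L²`. -/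
noncomputable abbrev toL2 : 𝓢(ℝ, ℂ) →L[ℂ] Lp ℂ 2 (volume : Measure ℝ) :=
  SchwartzMap.toLpCLM ℂ ℂ 2 volume

theorem inner_toL2 (φ ψ : 𝓢(ℝ, ℂ)) :
    inner ℂ (toL2 φ) (toL2 ψ) = ∫ t : ℝ, ψ t * conj (φ t) := by
  exact SchwartzMap.inner_toL2_toL2_eq φ ψ volume

theorem integral_norm_sq_eq (φ : 𝓢(ℝ, ℂ)) : ∫ t : ℝ, ‖φ t‖ ^ 2 = ‖toL2 φ‖ ^ 2 := by
  have h : ((∫ t : ℝ, ‖φ t‖ ^ 2 : ℝ) : ℂ) = ((‖toL2 φ‖ ^ 2 : ℝ) : ℂ) := by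
    rw [Complex.ofReal_pow, ← Complex.coe_algebraMap, ← inner_self_eq_norm_sq_to_K (𝕜 := ℂ),
      inner_toL2, Complex.coe_algebraMap, ← integral_complex_ofReal]
    refine integral_congr_ae (Eventually.of_forall fun t => ?_)
    simp only [Complex.mul_conj, Complex.normSq_eq_norm_sq]
  exact_mod_cast h

theorem map_re_complexGaussian (v : ℝ≥0) :
    (complexGaussian v).map Complex.re = gaussianReal 0 (v / 2) := by
  rw [complexGaussian, Measure.map_map (by fun_prop) (by fun_prop)]
  have h : Complex.re ∘ (fun p : ℝ × ℝ => (p.1 : ℂ) + p.2 * Complex.I) = Prod.fst := by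
    ext p
    simp
  rw [h, Measure.map_fst_prod, measure_univ, one_smul]

instance (v : ℝ≥0) : IsProbabilityMeasure (complexGaussian v) :=
  Measure.isProbabilityMeasure_map (by fun_prop)

/-- A real linear functional on `ℂⁿ` is the real part of a complex linear one. -/
theorem strongDual_pi_eq_re {ι : Type*} [Fintype ι] [DecidableEq ι]
    (L : (ι → ℂ) →L[ℝ] ℝ) (x : ι → ℂ) :
    L x = (∑ i, ((L (Pi.single i 1) : ℂ) - L (Pi.single i Complex.I) * Complex.I) * x i).re := by
  have h : x = ∑ i, ((x i).re • (Pi.single i (1 : ℂ) : ι → ℂ) +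
      (x i).im • (Pi.single i Complex.I : ι → ℂ)) := by
    ext j
    simp only [Finset.sum_apply, Pi.add_apply, Pi.smul_apply, Pi.single_apply, smul_ite, smul_zero,
      Finset.sum_add_distrib, Finset.sum_ite_eq, Finset.mem_univ, if_true]
    simp
  conv_lhs => rw [h]
  rw [map_sum, Complex.re_sum]
  refine Finset.sum_congr rfl fun i _ => ?_
  rw [map_add, map_smul, map_smul]
  simp
  ring

namespace IsComplexWhiteNoise

variable {Ω : Type*} [MeasurableSpace Ω] {P : Measure Ω} {ξ : Ω → 𝓢'(ℝ, ℂ)}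

theorem hasLaw (hξ : IsComplexWhiteNoise P ξ) (φ : 𝓢(ℝ, ℂ)) :
    HasLaw (fun ω => ξ ω φ) (complexGaussian (Real.toNNReal (‖toL2 φ‖ ^ 2))) P := by
  rw [← integral_norm_sq_eq]
  exact hξ φ

theorem hasLaw_re (hξ : IsComplexWhiteNoise P ξ) (φ : 𝓢(ℝ, ℂ)) :
    HasLaw (fun ω => (ξ ω φ).re) (gaussianReal 0 (Real.toNNReal (‖toL2 φ‖ ^ 2) / 2)) P := by
  have h : HasLaw Complex.re (gaussianReal 0 (Real.toNNReal (‖toL2 φ‖ ^ 2) / 2))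
      (complexGaussian (Real.toNNReal (‖toL2 φ‖ ^ 2))) :=
    ⟨by fun_prop, map_re_complexGaussian _⟩
  exact h.comp (hξ.hasLaw φ)

theorem isGaussianProcess (hξ : IsComplexWhiteNoise P ξ) {ι : Type*} (φ : ι → 𝓢(ℝ, ℂ)) :
    IsGaussianProcess (fun i ω => ξ ω (φ i)) P := by
  classical
  refine ⟨fun I => ⟨?_⟩⟩
  have hm : AEMeasurable (fun ω => I.restrict fun i => ξ ω (φ i)) P :=
    aemeasurable_pi_lambda _ fun i => (hξ (φ i)).aemeasurable
  refine isGaussian_of_map_eq_gaussianReal fun L => ?_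
  set ψ : 𝓢(ℝ, ℂ) := ∑ i : I,
    ((L (Pi.single i 1) : ℂ) - L (Pi.single i Complex.I) * Complex.I) • φ i
  refine ⟨_, _, Eq.trans ?_ (hξ.hasLaw_re ψ).map_eq⟩
  rw [AEMeasurable.map_map_of_aemeasurable (by fun_prop) hm]
  congr 1
  ext ω
  rw [Function.comp_apply, strongDual_pi_eq_re, map_sum]
  simp

theorem variance_re (hξ : IsComplexWhiteNoise P ξ) (φ : 𝓢(ℝ, ℂ)) :
    Var[fun ω => (ξ ω φ).re; P] = ‖toL2 φ‖ ^ 2 / 2 := by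
  rw [(hξ.hasLaw_re φ).variance_eq, variance_id_gaussianReal]
  simp

theorem covariance_re [IsProbabilityMeasure P] (hξ : IsComplexWhiteNoise P ξ) {φ ψ : 𝓢(ℝ, ℂ)}
    (h : inner ℂ (toL2 φ) (toL2 ψ) = 0) :
    cov[fun ω => (ξ ω φ).re, fun ω => (ξ ω ψ).re; P] = 0 := by
  have hL : ∀ φ : 𝓢(ℝ, ℂ), MemLp (fun ω => (ξ ω φ).re) 2 P := fun φ => by
    have := (hξ.hasLaw_re φ).hasGaussianLaw
    exact this.memLp_two
  have h1 := variance_add (hL φ) (hL ψ)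
  have h2 : (fun ω => (ξ ω φ).re) + (fun ω => (ξ ω ψ).re) = fun ω => (ξ ω (φ + ψ)).re := by
    ext ω
    simp
  rw [h2, hξ.variance_re, hξ.variance_re, hξ.variance_re, map_add, @norm_add_sq ℂ, h] at h1
  simp at h1
  linarith

/-- Orthogonal test functions give independent values of the noise. -/
theorem indepFun [IsProbabilityMeasure P] (hξ : IsComplexWhiteNoise P ξ) {ι κ : Type*}
    {φ : ι → 𝓢(ℝ, ℂ)} {ψ : κ → 𝓢(ℝ, ℂ)} (h : ∀ i j, inner ℂ (toL2 (φ i)) (toL2 (ψ j)) = 0) :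
    IndepFun (fun ω i => ξ ω (φ i)) (fun ω j => ξ ω (ψ j)) P := by
  refine IsGaussianProcess.indepFun_of_covariance_inner (X := fun i ω => ξ ω (φ i))
    (Y := fun j ω => ξ ω (ψ j)) ?_ (fun i => (hξ _).aemeasurable) (fun j => (hξ _).aemeasurable)
    fun i j x y => ?_
  · have h1 := hξ.isGaussianProcess (Sum.elim φ ψ)
    have h2 : Sum.elim (fun i ω => ξ ω (φ i)) (fun j ω => ξ ω (ψ j)) =
        fun i ω => ξ ω (Sum.elim φ ψ i) := by
      funext i
      cases i <;> rfl
    rw [h2]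
    exact h1
  · have h1 : inner ℂ (toL2 (conj x • φ i)) (toL2 (conj y • ψ j)) = 0 := by
      rw [map_smul, map_smul, inner_smul_left, inner_smul_right, h]
      simp
    refine Eq.trans ?_ (hξ.covariance_re h1)
    congr 1 <;> ext ω <;> simp [Complex.inner, mul_comm]

/-- The joint law of two orthogonal values of the noise. -/
theorem hasLaw_prod [IsProbabilityMeasure P] (hξ : IsComplexWhiteNoise P ξ) {φ ψ : 𝓢(ℝ, ℂ)}
    (h : inner ℂ (toL2 φ) (toL2 ψ) = 0) :
    HasLaw (fun ω => (ξ ω φ, ξ ω ψ))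
      ((complexGaussian (Real.toNNReal (‖toL2 φ‖ ^ 2))).prod
        (complexGaussian (Real.toNNReal (‖toL2 ψ‖ ^ 2)))) P := by
  have h1 := hξ.indepFun (φ := fun _ : Unit => φ) (ψ := fun _ : Unit => ψ) fun _ _ => h
  have h2 : IndepFun (fun ω => ξ ω φ) (fun ω => ξ ω ψ) P :=
    h1.comp (φ := fun f : Unit → ℂ => f ()) (ψ := fun f : Unit → ℂ => f ())
      (measurable_pi_apply _) (measurable_pi_apply _)
  exact (indepFun_iff_hasLaw_prodMk_prod (hξ.hasLaw φ) (hξ.hasLaw ψ)).1 h2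

end IsComplexWhiteNoise

end NoisySpectrogram

namespace NoisySpectrogram

open Set Filter Topology ComplexConjugate

/-! ### Integrals against complex Gaussian laws -/

theorem lintegral_complexGaussian (v : ℝ≥0) {f : ℂ → ℝ≥0∞} (hf : Measurable f) :
    ∫⁻ z, f z ∂complexGaussian v =
      ∫⁻ p : ℝ × ℝ, f ((p.1 : ℂ) + p.2 * Complex.I)
        ∂((gaussianReal 0 (v / 2)).prod (gaussianReal 0 (v / 2))) := by
  rw [complexGaussian, lintegral_map hf (by fun_prop)]

/-- The density `z ↦ exp(-‖z‖² / v) / (πv)` of the complex Gaussian law of variance `v`. -/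
noncomputable def complexGaussianDensity (v : ℝ) (z : ℂ) : ℝ≥0∞ :=
  ENNReal.ofReal (1 / (Real.pi * v) * Real.exp (-‖z‖ ^ 2 / v))

@[fun_prop]
theorem measurable_complexGaussianDensity (v : ℝ) : Measurable (complexGaussianDensity v) := by
  unfold complexGaussianDensity
  fun_prop

theorem complexGaussian_eq_withDensity {v : ℝ≥0} (hv : v ≠ 0) :
    complexGaussian v = volume.withDensity (complexGaussianDensity v) := by
  have hv2 : v / 2 ≠ 0 := by simpa using hv
  have hv' : (v : ℝ) ≠ 0 := by exact_mod_cast hv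
  ext A hA
  have hAm : Measurable fun p : ℝ × ℝ =>
      A.indicator (1 : ℂ → ℝ≥0∞) ((p.1 : ℂ) + p.2 * Complex.I) :=
    (measurable_one.indicator hA).comp (by fun_prop)
  rw [← lintegral_indicator_one hA, ← lintegral_indicator_one hA,
    lintegral_complexGaussian v (measurable_one.indicator hA),
    lintegral_withDensity_eq_lintegral_mul _ (measurable_complexGaussianDensity v)
      (measurable_one.indicator hA),
    gaussianReal_of_var_ne_zero _ hv2, prod_withDensity (by fun_prop) (by fun_prop),
    lintegral_withDensity_eq_lintegral_mul _ (by fun_prop) hAm,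
    ← Measure.volume_eq_prod, ← Complex.volume_preserving_equiv_real_prod.lintegral_comp_emb
      Complex.measurableEquivRealProd.measurableEmbedding]
  refine lintegral_congr fun z => ?_
  have hz : ((Complex.measurableEquivRealProd z).1 : ℂ) +
      (Complex.measurableEquivRealProd z).2 * Complex.I = z := Complex.re_add_im z
  simp only [Pi.mul_apply, hz]
  congr 1
  simp only [Complex.measurableEquivRealProd_apply, gaussianPDF, gaussianPDFReal,
    complexGaussianDensity]
  rw [← ENNReal.ofReal_mul (by positivity), mul_mul_mul_comm, ← Real.exp_add, ← mul_inv,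
    Real.mul_self_sqrt (by positivity), ← Complex.normSq_eq_norm_sq, Complex.normSq_apply]
  congr 2
  · push_cast
    field_simp
  · congr 1
    push_cast
    field_simp
    ring

theorem lintegral_add_sq_gaussianReal (a : ℝ) (v : ℝ≥0) :
    ∫⁻ x, ENNReal.ofReal ((a + x) ^ 2) ∂gaussianReal 0 v = ENNReal.ofReal (a ^ 2 + v) := by
  have hL : MemLp (fun x : ℝ => x) 2 (gaussianReal 0 v) := memLp_id_gaussianReal 2
  have h1 : Integrable (fun x : ℝ => x) (gaussianReal 0 v) := hL.integrable (by norm_num)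
  have h2 : Integrable (fun x : ℝ => x ^ 2) (gaussianReal 0 v) := hL.integrable_sq
  have h3 : ∫ x, x ^ 2 ∂gaussianReal 0 v = v := by
    have h := variance_eq_sub hL
    rw [variance_fun_id_gaussianReal, integral_id_gaussianReal] at h
    simpa using h.symm
  have h4 : ∀ x : ℝ, (a + x) ^ 2 = a ^ 2 + 2 * a * x + x ^ 2 := fun x => by ring
  have h5 : Integrable (fun x : ℝ => a ^ 2 + 2 * a * x) (gaussianReal 0 v) :=
    (integrable_const _).add (h1.const_mul _)
  have h6 := ofReal_integral_eq_lintegral_ofReal (h5.add h2) (Eventually.of_forall fun x => by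
    have := sq_nonneg (a + x)
    simp only [Pi.zero_apply, Pi.add_apply]
    linarith [h4 x])
  simp only [Pi.add_apply] at h6
  simp_rw [h4]
  rw [← h6, integral_add h5 h2, integral_add (integrable_const _) (h1.const_mul _), integral_const_mul,
    integral_id_gaussianReal, h3]
  simp

theorem lintegral_norm_add_sq_complexGaussian (b : ℂ) (v : ℝ≥0) :
    ∫⁻ z, ENNReal.ofReal (‖b + z‖ ^ 2) ∂complexGaussian v = ENNReal.ofReal (‖b‖ ^ 2 + v) := by
  rw [lintegral_complexGaussian v (by fun_prop)]
  have h : ∀ p : ℝ × ℝ, ENNReal.ofReal (‖b + ((p.1 : ℂ) + p.2 * Complex.I)‖ ^ 2) =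
      ENNReal.ofReal ((b.re + p.1) ^ 2) + ENNReal.ofReal ((b.im + p.2) ^ 2) := fun p => by
    rw [← ENNReal.ofReal_add (by positivity) (by positivity), ← Complex.normSq_eq_norm_sq,
      Complex.normSq_apply]
    simp [sq]
  simp_rw [h]
  rw [lintegral_add_left (by fun_prop), lintegral_prod _ (by fun_prop),
    lintegral_prod _ (by fun_prop)]
  simp only [lintegral_const, measure_univ, mul_one, lintegral_add_sq_gaussianReal]
  rw [← ENNReal.ofReal_add (by positivity) (by positivity), ← Complex.normSq_eq_norm_sq b,
    Complex.normSq_apply]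
  congr 1
  push_cast
  ring

theorem lintegral_norm_add_mul_sq_complexGaussian (b α : ℂ) (v : ℝ≥0) :
    ∫⁻ z, ENNReal.ofReal (‖b + α * z‖ ^ 2) ∂complexGaussian v =
      ENNReal.ofReal (‖b‖ ^ 2 + ‖α‖ ^ 2 * v) := by
  by_cases hα : α = 0
  · simp [hα]
  · have h : ∀ z, ENNReal.ofReal (‖b + α * z‖ ^ 2) =
        ENNReal.ofReal (‖α‖ ^ 2) * ENNReal.ofReal (‖b / α + z‖ ^ 2) := fun z => by
      rw [← ENNReal.ofReal_mul (by positivity), ← mul_pow, ← norm_mul]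
      congr 3
      field_simp
    simp_rw [h]
    rw [lintegral_const_mul _ (by fun_prop), lintegral_norm_add_sq_complexGaussian,
      ← ENNReal.ofReal_mul (by positivity)]
    congr 1
    rw [norm_div]
    have : ‖α‖ ≠ 0 := by simpa using hα
    field_simp

/-- Completing the square: conditioning a complex Gaussian of variance `s` on the sum with an
independent standard one. -/
theorem complexGaussianDensity_mul {s : ℝ} (hs : 0 < s) (m x : ℂ) :
    complexGaussianDensity s x * complexGaussianDensity 1 (m + x) =
      ENNReal.ofReal (1 / (Real.pi * (1 + s)) * Real.exp (-‖m‖ ^ 2 / (1 + s))) *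
        complexGaussianDensity (s / (1 + s)) (x + (s / (1 + s) : ℝ) * m) := by
  have hpi := Real.pi_pos
  have h1 : 0 < 1 + s := by linarith
  unfold complexGaussianDensity
  rw [← ENNReal.ofReal_mul (by positivity), ← ENNReal.ofReal_mul (by positivity),
    mul_mul_mul_comm, ← Real.exp_add, mul_mul_mul_comm, ← Real.exp_add]
  congr 2
  · field_simp
  · congr 1
    simp only [← Complex.normSq_eq_norm_sq, Complex.normSq_apply, Complex.add_re, Complex.add_im,
      Complex.re_ofReal_mul, Complex.im_ofReal_mul]
    field_simp
    ring

/-- The second moment behind the zero intensity: if `X` and `Y` are independent complex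
Gaussian variables of variances `s` and `τ`, this is the average of `‖b + αX + Y‖²` weighted by the
density at `0` of `m + X` plus an independent standard complex Gaussian variable. -/
theorem lintegral_norm_sq_mul_density {s τ : ℝ≥0} (hs : s ≠ 0) (b α m : ℂ) :
    ∫⁻ p : ℂ × ℂ, ENNReal.ofReal (‖b + α * p.1 + p.2‖ ^ 2) * complexGaussianDensity 1 (m + p.1)
        ∂((complexGaussian s).prod (complexGaussian τ)) =
      ENNReal.ofReal ((‖b - α * ((s / (1 + s) : ℝ) * m)‖ ^ 2 + ‖α‖ ^ 2 * (s / (1 + s)) + τ) *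
        (1 / (Real.pi * (1 + s)) * Real.exp (-‖m‖ ^ 2 / (1 + s)))) := by
  have hs' : (0 : ℝ) < s := by exact_mod_cast pos_iff_ne_zero.2 hs
  have hpi := Real.pi_pos
  set v : ℝ≥0 := s / (1 + s) with hv
  have hv0 : v ≠ 0 := by positivity
  have hvr : (v : ℝ) = s / (1 + s) := by push_cast [hv]; rfl
  rw [lintegral_prod _ (by fun_prop)]
  have h1 : ∀ x : ℂ, ∫⁻ y, ENNReal.ofReal (‖b + α * x + y‖ ^ 2) * complexGaussianDensity 1 (m + x)
      ∂complexGaussian τ =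
      ENNReal.ofReal (‖b + α * x‖ ^ 2 + τ) * complexGaussianDensity 1 (m + x) := fun x => by
    rw [lintegral_mul_const _ (by fun_prop), lintegral_norm_add_sq_complexGaussian]
  simp_rw [h1]
  rw [complexGaussian_eq_withDensity hs, lintegral_withDensity_eq_lintegral_mul _ (by fun_prop)
    (by fun_prop)]
  have h2 : ∀ x : ℂ, (complexGaussianDensity s * fun x =>
      ENNReal.ofReal (‖b + α * x‖ ^ 2 + τ) * complexGaussianDensity 1 (m + x)) x =
      ENNReal.ofReal (1 / (Real.pi * (1 + s)) * Real.exp (-‖m‖ ^ 2 / (1 + s))) *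
        (complexGaussianDensity v (x + v * m) * ENNReal.ofReal (‖b + α * x‖ ^ 2 + τ)) := fun x => by
    have h := complexGaussianDensity_mul hs' m x
    rw [← hvr] at h
    rw [Pi.mul_apply, mul_left_comm, h]
    ring
  simp_rw [h2]
  rw [lintegral_const_mul _ (by fun_prop), ← lintegral_add_right_eq_self _ (-((v : ℂ) * m))]
  simp only [neg_add_cancel_right]
  have h3 := lintegral_withDensity_eq_lintegral_mul volume (measurable_complexGaussianDensity v)
    (g := fun x => ENNReal.ofReal (‖b + α * (x + -((v : ℂ) * m))‖ ^ 2 + τ)) (by fun_prop)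
  simp only [Pi.mul_apply] at h3
  have h4 : ∀ x : ℂ, ENNReal.ofReal (‖b + α * (x + -((v : ℂ) * m))‖ ^ 2 + τ) =
      ENNReal.ofReal (‖(b - α * (v * m)) + α * x‖ ^ 2) + ENNReal.ofReal τ := fun x => by
    rw [← ENNReal.ofReal_add (by positivity) (by positivity)]
    ring_nf
  rw [← h3, ← complexGaussian_eq_withDensity hv0]
  simp_rw [h4]
  rw [lintegral_add_left (by fun_prop), lintegral_norm_add_mul_sq_complexGaussian, lintegral_const,
    measure_univ, mul_one, ← ENNReal.ofReal_add (by positivity) (by positivity),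
    ← ENNReal.ofReal_mul (by positivity), mul_comm, ← hvr]

end NoisySpectrogram

namespace NoisySpectrogram

open Set Filter Topology ComplexConjugate

/-! ### The Kac–Rice density at a point -/

theorem inner_coherent (v w : ℂ) :
    inner ℂ (toL2 (coherent v)) (toL2 (coherent w)) = Complex.exp (Real.pi * (w * conj v)) := by
  rw [inner_toL2, integral_coherent_mul_conj]

theorem inner_coherent_coherentDeriv (v w : ℂ) :
    inner ℂ (toL2 (coherent v)) (toL2 (coherentDeriv w)) =
      Real.pi * conj v * Complex.exp (Real.pi * (w * conj v)) := by
  rw [inner_toL2, integral_coherentDeriv_mul_conj]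

theorem inner_coherentDeriv_self (w : ℂ) :
    inner ℂ (toL2 (coherentDeriv w)) (toL2 (coherentDeriv w)) =
      Real.pi * (1 + Real.pi * (w * conj w)) * Complex.exp (Real.pi * (w * conj w)) := by
  rw [inner_toL2, integral_coherentDeriv_mul_conj_self]

/-- The intensity of the zeros of the Bargmann transform of white noise plus the entire function
`m`. -/
noncomputable def zeroIntensity (m : ℂ → ℂ) (w : ℂ) : ℝ :=
  (1 + ‖deriv m w - Real.pi * conj w * m w‖ ^ 2 / Real.pi * Real.exp (-(Real.pi * ‖w‖ ^ 2))) *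
    Real.exp (-(‖m w‖ ^ 2 * Real.exp (-(Real.pi * ‖w‖ ^ 2))))

variable {Ω : Type*} [MeasurableSpace Ω] {P : Measure Ω} {ξ : Ω → 𝓢'(ℝ, ℂ)}

theorem lintegral_norm_sq_mul_density_eq_zeroIntensity [IsProbabilityMeasure P]
    (hξ : IsComplexWhiteNoise P ξ) (m : ℂ → ℂ) {w : ℂ} (hw : w ≠ 0) :
    ∫⁻ ω, ENNReal.ofReal (‖deriv m w + ξ ω (coherentDeriv w)‖ ^ 2) *
        complexGaussianDensity 1 (m w + ξ ω (coherent w - coherent 0)) ∂P =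
      ENNReal.ofReal (zeroIntensity m w) := by
  have hpi := Real.pi_pos
  set r : ℝ := Real.pi * ‖w‖ ^ 2 with hr
  have hr0 : 0 < r := by positivity
  set s : ℝ := Real.exp r - 1 with hs
  have hs0 : 0 < s := by
    have := Real.add_one_lt_exp hr0.ne'
    simp only [hs]
    linarith
  have hsC : (s : ℂ) ≠ 0 := by exact_mod_cast hs0.ne'
  have hrw : (Real.pi : ℂ) * (w * conj w) = r := by
    rw [Complex.mul_conj, Complex.normSq_eq_norm_sq, hr]
    push_cast
    rfl
  have hexp : Complex.exp r = (Real.exp r : ℂ) := (Complex.ofReal_exp r).symm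
  set η : 𝓢(ℝ, ℂ) := coherent w - coherent 0 with hη
  set α : ℂ := Real.pi * conj w * Real.exp r / s with hα
  -- the component of `coherentDeriv w` orthogonal to `η`
  set ζ : 𝓢(ℝ, ℂ) := coherentDeriv w - α • η with hζ
  have hηη : inner ℂ (toL2 η) (toL2 η) = (s : ℂ) := by
    simp only [hη, map_sub, inner_sub_left, inner_sub_right, inner_coherent, hrw, hexp]
    simp [hs]
  have hηχ : inner ℂ (toL2 η) (toL2 (coherentDeriv w)) = Real.pi * conj w * Real.exp r := by
    simp only [hη, map_sub, inner_sub_left, inner_coherent_coherentDeriv, hrw, hexp]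
    simp
  have hLζ : toL2 ζ = toL2 (coherentDeriv w) - α • toL2 η := by
    rw [hζ, map_sub toL2 (coherentDeriv w), map_smul]
  have hηζ : inner ℂ (toL2 η) (toL2 ζ) = 0 := by
    rw [hLζ, inner_sub_right, inner_smul_right, hηη, hηχ, hα]
    field_simp
    ring
  have hχη : inner ℂ (toL2 (coherentDeriv w)) (toL2 η) = Real.pi * w * Real.exp r := by
    rw [← inner_conj_symm, hηχ]
    simp only [map_mul, Complex.conj_ofReal, Complex.conj_conj]
  have hζζ : inner ℂ (toL2 ζ) (toL2 ζ) =
      ((Real.pi * (1 + r) * Real.exp r - Real.pi * r * Real.exp r ^ 2 / s : ℝ) : ℂ) := by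
    have h1 : inner ℂ (toL2 ζ) (toL2 ζ) = inner ℂ (toL2 (coherentDeriv w)) (toL2 ζ) := by
      nth_rewrite 1 [hLζ]
      rw [inner_sub_left, inner_smul_left, hηζ, mul_zero, sub_zero]
    rw [h1, hLζ, inner_sub_right, inner_smul_right, hχη, inner_coherentDeriv_self,
      hrw, hexp, hα]
    push_cast
    rw [← hrw]
    field_simp
  have hnη : ‖toL2 η‖ ^ 2 = s := by
    rw [← inner_self_eq_norm_sq (𝕜 := ℂ), hηη]
    simp
  have hnζ : ‖toL2 ζ‖ ^ 2 = Real.pi * (1 + r) * Real.exp r - Real.pi * r * Real.exp r ^ 2 / s := by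
    rw [← inner_self_eq_norm_sq (𝕜 := ℂ), hζζ]
    exact Complex.ofReal_re _
  have hlaw := hξ.hasLaw_prod hηζ
  rw [hnη, hnζ] at hlaw
  have h1 := hlaw.lintegral_comp (f := fun p : ℂ × ℂ =>
    ENNReal.ofReal (‖deriv m w + α * p.1 + p.2‖ ^ 2) * complexGaussianDensity 1 (m w + p.1))
    (Measurable.aemeasurable (by fun_prop))
  rw [lintegral_norm_sq_mul_density (by simpa using hs0)] at h1
  have hτ : 0 ≤ Real.pi * (1 + r) * Real.exp r - Real.pi * r * Real.exp r ^ 2 / s :=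
    hnζ ▸ sq_nonneg _
  rw [Real.coe_toNNReal _ hs0.le, Real.coe_toNNReal _ hτ] at h1
  refine (lintegral_congr fun ω => ?_).trans (h1.trans ?_)
  · have h2 : ξ ω (coherentDeriv w) = α * ξ ω η + ξ ω ζ := by
      rw [hζ, map_sub (ξ ω) (coherentDeriv w), map_smul, smul_eq_mul]
      ring
    rw [h2, add_assoc]
  · have hs1 : 1 + s = Real.exp r := by simp [hs]
    have hE : Real.exp r ≠ 0 := (Real.exp_pos r).ne'
    have h3 : α * ((s / (1 + s) : ℝ) * m w) = Real.pi * conj w * m w := by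
      have hEC : (Real.exp r : ℂ) ≠ 0 := by exact_mod_cast hE
      rw [hs1, hα]
      push_cast
      push_cast at hEC
      field_simp
    have hπr : Real.pi * r = Real.pi ^ 2 * ‖w‖ ^ 2 := by
      rw [hr]
      ring
    have h4 : ‖α‖ ^ 2 = Real.pi * r * Real.exp r ^ 2 / s ^ 2 := by
      rw [hα, norm_div, norm_mul, norm_mul, Complex.norm_conj, Complex.norm_real, Complex.norm_real,
        Complex.norm_real, Real.norm_of_nonneg hpi.le, Real.norm_of_nonneg (Real.exp_pos r).le,
        Real.norm_of_nonneg hs0.le, hπr, div_pow, mul_pow, mul_pow]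
    have h5 : ‖α‖ ^ 2 * (s / (1 + s)) + (Real.pi * (1 + r) * Real.exp r -
        Real.pi * r * Real.exp r ^ 2 / s) = Real.pi * Real.exp r := by
      rw [h4, hs1]
      have h6 : Real.exp r = s + 1 := by simp [hs]
      rw [h6] at hE ⊢
      field_simp
      ring
    rw [h3, add_assoc, h5, zeroIntensity, ← hr, hs1, Real.exp_neg r]
    congr 1
    rw [neg_div, div_eq_mul_inv (‖m w‖ ^ 2)]
    field_simp
    ring

/-! ### The number of zeros of a random entire function -/

theorem finite_zeros_inter_closedBall {f : ℂ → ℂ} (hf : Differentiable ℂ f) (h0 : f 0 ≠ 0) (R : ℝ) :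
    (Metric.closedBall 0 R ∩ f ⁻¹' {0}).Finite := by
  by_contra hinf
  obtain ⟨z, -, hz⟩ := Set.Infinite.exists_accPt_of_subset_isCompact hinf
    (isCompact_closedBall (0 : ℂ) R) inter_subset_left
  have hfreq : ∃ᶠ w in 𝓝[≠] z, f w = 0 :=
    (accPt_iff_frequently_nhdsNE.1 hz).mono fun w hw => hw.2
  have han : AnalyticOnNhd ℂ f univ := fun w _ => hf.analyticAt w
  exact h0 (han.eqOn_zero_of_preconnected_of_frequently_eq_zero isPreconnected_univ (mem_univ z)
    hfreq (mem_univ 0))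

/-- A process with continuous paths and almost everywhere measurable values is jointly almost
everywhere measurable. -/
theorem aemeasurable_uncurry_of_continuous [SFinite P] {f : Ω → ℂ → ℂ}
    (hm : ∀ z, AEMeasurable (fun ω => f ω z) P)
    (hc : ∀ ω, Continuous (f ω)) (μ : Measure ℂ) [SFinite μ] :
    AEMeasurable (Function.uncurry f) (P.prod μ) := by
  classical
  set d := TopologicalSpace.denseSeq ℂ
  have hae : ∀ᵐ ω ∂P, ∀ n, f ω (d n) = (hm (d n)).mk _ ω :=
    ae_all_iff.2 fun n => (hm (d n)).ae_eq_mk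
  obtain ⟨N, hNsub, hN, hN0⟩ := exists_measurable_superset_of_null (ae_iff.1 hae)
  set g : Ω → ℂ → ℂ := fun ω z => if ω ∈ N then 0 else f ω z with hg
  have hgc : ∀ ω, Continuous (g ω) := fun ω => by
    by_cases h : ω ∈ N
    · simpa [hg, h] using continuous_const
    · simpa [hg, h] using hc ω
  have hgd : ∀ n, Measurable fun ω => g ω (d n) := fun n => by
    have h : (fun ω => g ω (d n)) = fun ω => if ω ∈ N then 0 else (hm (d n)).mk _ ω := by
      ext ω
      by_cases h : ω ∈ N
      · simp [hg, h]
      · have h2 : ∀ n, f ω (d n) = (hm (d n)).mk _ ω := by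
          by_contra h3
          exact h (hNsub h3)
        simp [hg, h, h2 n]
    rw [h]
    exact Measurable.ite hN measurable_const (hm (d n)).measurable_mk
  have hgm : ∀ z, Measurable fun ω => g ω z := fun z => by
    have h : ∃ u : ℕ → ℕ, Tendsto (fun n => d (u n)) atTop (𝓝 z) := by
      obtain ⟨v, hv, hlim⟩ := mem_closure_iff_seq_limit.1
        (TopologicalSpace.denseRange_denseSeq ℂ z)
      choose u hu using hv
      exact ⟨u, by simpa only [d, hu] using hlim⟩
    obtain ⟨u, hu⟩ := h
    exact measurable_of_tendsto_metrizable (fun n => hgd (u n))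
      (tendsto_pi_nhds.2 fun ω => ((hgc ω).tendsto z).comp hu)
  have hgu : Measurable (Function.uncurry g) :=
    (measurable_uncurry_of_continuous_of_measurable (u := fun z ω => g ω z) hgc hgm).comp
      measurable_swap
  refine ⟨_, hgu, ?_⟩
  have h : ∀ᵐ p ∂P.prod μ, p.1 ∉ N :=
    Measure.quasiMeasurePreserving_fst.ae (measure_eq_zero_iff_ae_notMem.1 hN0)
  filter_upwards [h] with p hp
  simp [hg, hp, Function.uncurry]

theorem complexGaussian_one_singleton (z : ℂ) : complexGaussian 1 {z} = 0 := by
  rw [complexGaussian_eq_withDensity one_ne_zero]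
  exact withDensity_absolutelyContinuous _ _ (measure_singleton z)

theorem IsComplexWhiteNoise.hasLaw_coherent_zero (hξ : IsComplexWhiteNoise P ξ) :
    HasLaw (fun ω => ξ ω (coherent 0)) (complexGaussian 1) P := by
  have h := hξ.hasLaw (coherent 0)
  have h2 : ‖toL2 (coherent 0)‖ ^ 2 = 1 := by
    rw [← inner_self_eq_norm_sq (𝕜 := ℂ), inner_coherent]
    simp
  rwa [h2, Real.toNNReal_one] at h

theorem lintegral_count_preimage_complexGaussian {f : ℂ → ℂ} (hf : Differentiable ℂ f) {A : Set ℂ}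
    (hA : MeasurableSet A) {Ψ : ℂ → ℝ≥0∞} (hΨ : Measurable Ψ)
    (h : ∀ a, a + f 0 ≠ 0 → Ψ a = Measure.count (A ∩ (fun z => a + f z) ⁻¹' {0})) :
    ∫⁻ a, Ψ a ∂complexGaussian 1 =
      ∫⁻ z in A, ENNReal.ofReal (‖deriv f z‖ ^ 2) * complexGaussianDensity 1 (f z) := by
  have h1 := lintegral_count_preimage_mul (f := fun z => -f z) hf.neg hA
    (measurable_complexGaussianDensity 1)
  have h2 : ∀ z, complexGaussianDensity 1 (-z) = complexGaussianDensity 1 z := fun z => by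
    simp [complexGaussianDensity]
  have h3 : ∀ z, deriv (fun z => -f z) z = -deriv f z := fun z => deriv.fun_neg
  simp_rw [h2, h3, norm_neg] at h1
  rw [← h1, complexGaussian_eq_withDensity one_ne_zero,
    lintegral_withDensity_eq_lintegral_mul _ (by fun_prop) hΨ]
  refine lintegral_congr_ae ?_
  have hne : ∀ᵐ a : ℂ, a ≠ -f 0 := by
    rw [ae_iff]
    simp
  filter_upwards [hne] with a ha
  rw [Pi.mul_apply, h a fun h0 => ha (eq_neg_of_add_eq_zero_left h0), mul_comm]
  congr 3
  ext z
  simp [neg_eq_iff_add_eq_zero, add_comm]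

/-- Zeros of the Bargmann transform of white noise plus an entire function `m`. The value at `0` of
the noise is a Gaussian variable independent of the increments, so the expected number of zeros is an
average over the increments of the number of preimages of a Gaussian point. -/
theorem aemeasurable_and_lintegral_count_zeros [IsProbabilityMeasure P]
    (hξ : IsComplexWhiteNoise P ξ) {m : ℂ → ℂ} (hm : Differentiable ℂ m) {A : Set ℂ}
    (hA : MeasurableSet A) (hAb : Bornology.IsBounded A) :
    AEMeasurable (fun ω => Measure.count (A ∩ (fun w => m w + ξ ω (coherent w)) ⁻¹' {0})) P ∧
      ∫⁻ ω, Measure.count (A ∩ (fun w => m w + ξ ω (coherent w)) ⁻¹' {0}) ∂P =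
        ∫⁻ w in A, ENNReal.ofReal (zeroIntensity m w) := by
  obtain ⟨R, hR⟩ := hAb.subset_closedBall 0
  set d := TopologicalSpace.denseSeq ℂ
  obtain ⟨Φ, hΦ, hcount⟩ := exists_measurable_count_zeros
    (TopologicalSpace.denseRange_denseSeq ℂ) R hA
  have hcount' : ∀ f : ℂ → ℂ, Differentiable ℂ f → f 0 ≠ 0 →
      Φ (fun n => f (d n)) = Measure.count (A ∩ f ⁻¹' {0}) := fun f hf h0 => by
    rw [hcount f hf.continuous (finite_zeros_inter_closedBall hf h0 R), ← inter_assoc,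
      inter_eq_left.2 hR]
  have hder : ∀ ω w, HasDerivAt (fun w => m w + ξ ω (coherent w))
      (deriv m w + ξ ω (coherentDeriv w)) w := fun ω w =>
    (hm w).hasDerivAt.add (hasDerivAt_bargmann (ξ ω) w)
  have hne : ∀ᵐ ω ∂P, m 0 + ξ ω (coherent 0) ≠ 0 := by
    have h1 : ∀ᵐ a ∂complexGaussian 1, a ≠ -m 0 :=
      measure_eq_zero_iff_ae_notMem.1 (complexGaussian_one_singleton (-m 0))
    rw [← hξ.hasLaw_coherent_zero.map_eq] at h1
    filter_upwards [ae_of_ae_map hξ.hasLaw_coherent_zero.aemeasurable h1] with ω hω h0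
    exact hω (eq_neg_of_add_eq_zero_right h0)
  have hae : (fun ω => Φ fun n => m (d n) + ξ ω (coherent (d n))) =ᵐ[P]
      fun ω => Measure.count (A ∩ (fun w => m w + ξ ω (coherent w)) ⁻¹' {0}) := by
    filter_upwards [hne] with ω hω
    exact hcount' _ (fun w => (hder ω w).differentiableAt) hω
  have hΦm : AEMeasurable (fun ω => Φ fun n => m (d n) + ξ ω (coherent (d n))) P :=
    hΦ.comp_aemeasurable (aemeasurable_pi_lambda _ fun n => (hξ _).aemeasurable.const_add _)
  refine ⟨hΦm.congr hae, ?_⟩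
  rw [← lintegral_congr_ae hae]
  -- the increments `G` of the Bargmann transform are independent of its value at `0`
  set G : Ω → ℂ → ℂ := fun ω w => m w + ξ ω (coherent w - coherent 0) with hG
  have hGder : ∀ ω w, HasDerivAt (G ω) (deriv m w + ξ ω (coherentDeriv w)) w := fun ω w => by
    have h := (hder ω w).sub_const (ξ ω (coherent 0))
    refine h.congr_of_eventuallyEq (Eventually.of_forall fun w => ?_)
    simp only [hG, map_sub]
    ring
  have hindep : IndepFun (fun ω => ξ ω (coherent 0))
      (fun ω n => ξ ω (coherent (d n) - coherent 0)) P := by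
    have h := hξ.indepFun (φ := fun _ : Unit => coherent 0)
      (ψ := fun n => coherent (d n) - coherent 0) fun _ n => by
        rw [map_sub, inner_sub_right, inner_coherent, inner_coherent]
        simp
    exact h.comp (φ := fun f : Unit → ℂ => f ()) (ψ := id) (measurable_pi_apply _) measurable_id
  have hgm : AEMeasurable (fun ω n => ξ ω (coherent (d n) - coherent 0)) P :=
    aemeasurable_pi_lambda _ fun n => (hξ _).aemeasurable
  have hΦ2 : Measurable fun p : ℂ × (ℕ → ℂ) => Φ fun n => p.1 + (m (d n) + p.2 n) :=
    hΦ.comp (measurable_pi_lambda _ fun n => by fun_prop)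
  have hsplit : ∫⁻ ω, Φ (fun n => m (d n) + ξ ω (coherent (d n))) ∂P =
      ∫⁻ ω, ∫⁻ a, Φ (fun n => a + G ω (d n)) ∂complexGaussian 1 ∂P := by
    have h1 : ∀ ω, Φ (fun n => m (d n) + ξ ω (coherent (d n))) =
        (fun p : ℂ × (ℕ → ℂ) => Φ fun n => p.1 + (m (d n) + p.2 n))
          (ξ ω (coherent 0), fun n => ξ ω (coherent (d n) - coherent 0)) := fun ω => by
      congr 1
      ext n
      simp only [map_sub]
      ring
    simp_rw [h1]
    rw [← lintegral_map' hΦ2.aemeasurable (hξ.hasLaw_coherent_zero.aemeasurable.prodMk hgm),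
      (indepFun_iff_map_prod_eq_prod_map_map hξ.hasLaw_coherent_zero.aemeasurable hgm).1 hindep,
      hξ.hasLaw_coherent_zero.map_eq]
    have : IsProbabilityMeasure (P.map fun ω n => ξ ω (coherent (d n) - coherent 0)) :=
      Measure.isProbabilityMeasure_map hgm
    rw [lintegral_prod_symm' _ hΦ2, lintegral_map' hΦ2.lintegral_prod_left'.aemeasurable hgm]
  have hinner : ∀ ω, ∫⁻ a, Φ (fun n => a + G ω (d n)) ∂complexGaussian 1 =
      ∫⁻ w in A, ENNReal.ofReal (‖deriv m w + ξ ω (coherentDeriv w)‖ ^ 2) *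
        complexGaussianDensity 1 (G ω w) := fun ω => by
    have hd : Differentiable ℂ (G ω) := fun w => (hGder ω w).differentiableAt
    have hΦa : Measurable fun a => Φ fun n => a + G ω (d n) :=
      hΦ.comp (measurable_pi_lambda _ fun n => by fun_prop)
    rw [lintegral_count_preimage_complexGaussian hd hA hΦa fun a ha => hcount' (fun z => a + G ω z) (hd.const_add a) ha]
    simp_rw [(hGder ω _).deriv]
  rw [hsplit]
  simp_rw [hinner]
  -- the integrand is jointly measurable, so the average can be taken at a fixed point `w`
  have hj1 : AEMeasurable (Function.uncurry fun ω w => deriv m w + ξ ω (coherentDeriv w))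
      (P.prod (volume.restrict A)) := by
    refine aemeasurable_uncurry_of_continuous (fun w => (hξ _).aemeasurable.const_add _)
      (fun ω => ?_) _
    have hd : Differentiable ℂ (G ω) := fun w => (hGder ω w).differentiableAt
    have h : (fun w => deriv m w + ξ ω (coherentDeriv w)) = deriv (G ω) :=
      funext fun w => (hGder ω w).deriv.symm
    rw [h]
    exact (hd.contDiff (n := 1)).continuous_deriv le_rfl
  have hj2 : AEMeasurable (Function.uncurry G) (P.prod (volume.restrict A)) :=
    aemeasurable_uncurry_of_continuous (fun w => (hξ _).aemeasurable.const_add _)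
      (fun ω => (Differentiable.continuous (𝕜 := ℂ)
        fun w => (hGder ω w).differentiableAt)) _
  rw [lintegral_lintegral_swap (by
    exact ((hj1.norm.pow_const 2).ennreal_ofReal).mul
      ((measurable_complexGaussianDensity 1).comp_aemeasurable hj2))]
  refine lintegral_congr_ae (ae_restrict_of_ae ?_)
  -- at `w = 0` the increment is degenerate
  have h0 : ∀ᵐ w : ℂ, w ≠ 0 := by
    rw [ae_iff]
    simp
  filter_upwards [h0] with w hw
  exact lintegral_norm_sq_mul_density_eq_zeroIntensity hξ m hw

/-! ### Zeros of the noisy spectrogram -/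

theorem zeroIntensity_monomial {k : ℕ} (hk : 1 ≤ k) {γ : ℝ} {σ : ℂ}
    (hσ : ‖σ‖ ^ 2 = γ * (Real.pi ^ k / k.factorial)) (w : ℂ) :
    zeroIntensity (fun w => σ * w ^ k) w =
      (1 + γ * ((Real.pi * ‖w‖ ^ 2) ^ (k - 1) / (k.factorial : ℝ)) *
        ((k : ℝ) - Real.pi * ‖w‖ ^ 2) ^ 2 * Real.exp (-(Real.pi * ‖w‖ ^ 2))) *
      Real.exp (-(γ * ((Real.pi * ‖w‖ ^ 2) ^ k / (k.factorial : ℝ)) *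
        Real.exp (-(Real.pi * ‖w‖ ^ 2)))) := by
  obtain ⟨k, rfl⟩ : ∃ j, k = j + 1 := ⟨k - 1, by omega⟩
  have hpi := Real.pi_pos
  have h1 : deriv (fun w : ℂ => σ * w ^ (k + 1)) w - Real.pi * conj w * (σ * w ^ (k + 1)) =
      σ * w ^ k * (((k + 1 : ℕ) : ℝ) - Real.pi * ‖w‖ ^ 2 : ℝ) := by
    have h2 : w * conj w = ((‖w‖ ^ 2 : ℝ) : ℂ) := by
      rw [Complex.mul_conj, Complex.normSq_eq_norm_sq]
    have h3 : deriv (fun w : ℂ => σ * w ^ (k + 1)) w = σ * (((k + 1 : ℕ) : ℂ) * w ^ k) := by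
      simp
    rw [h3]
    push_cast at h2 ⊢
    rw [← h2]
    ring
  rw [zeroIntensity, h1, norm_mul, norm_mul, norm_mul, mul_pow, mul_pow, mul_pow, hσ,
    Complex.norm_real, Real.norm_eq_abs, sq_abs, norm_pow, norm_pow]
  have h4 : ∀ j : ℕ, (‖w‖ ^ j) ^ 2 = (‖w‖ ^ 2) ^ j := fun j => by
    rw [← pow_mul, ← pow_mul, mul_comm]
  rw [h4, h4, Nat.add_sub_cancel, mul_pow, mul_pow]
  congr 2
  · congr 2
    field_simp
    ring
  · congr 2
    ring

theorem zeroCount_eq_count {y : 𝓢'(ℝ, ℂ)} {A : Set ℂ} (hA : MeasurableSet A) :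
    zeroCount y A = Measure.count (conj ⁻¹' A ∩ (fun w => y (coherent w)) ⁻¹' {0}) := by
  have hc : Continuous fun w => y (coherent w) :=
    (Differentiable.continuous (𝕜 := ℂ) fun w => (hasDerivAt_bargmann y w).differentiableAt)
  have hset : {z | z ∈ A ∧ spectrogram y z = 0} =
      conj ⁻¹' (conj ⁻¹' A ∩ (fun w => y (coherent w)) ⁻¹' {0}) := by
    ext z
    simp [spectrogram_eq_zero_iff]
  rw [Measure.count_apply ((Complex.continuous_conj.measurable hA).inter
    (hc.measurable (measurableSet_singleton 0))), zeroCount, hset,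
    encard_preimage_of_bijective (Function.Involutive.bijective Complex.conj_conj)]

end NoisySpectrogram

open NoisySpectrogram in
theorem proposition2 {Ω : Type*} [MeasurableSpace Ω] (P : MeasureTheory.Measure Ω)
    [MeasureTheory.IsProbabilityMeasure P]
    (ξ : Ω → 𝓢'(ℝ, ℂ)) (hξ : NoisySpectrogram.IsComplexWhiteNoise P ξ)
    (k : ℕ) (hk : 1 ≤ k) (γ : ℝ) (hγ : 0 < γ)
    (h : MeasureTheory.Lp ℂ 2 (MeasureTheory.volume : MeasureTheory.Measure ℝ))
    (hh : NoisySpectrogram.IsHermiteFunction k h) :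
    NoisySpectrogram.IsZeroIntensity P
      (fun ω => ξ ω + ((Real.sqrt γ : ℝ) : ℂ) • (h : 𝓢'(ℝ, ℂ)))
      (fun z : ℂ =>
        let r : ℝ := Real.pi * ‖z‖ ^ 2
        (1 + γ * (r ^ (k - 1) / (k.factorial : ℝ)) * ((k : ℝ) - r) ^ 2 * Real.exp (-r)) *
          Real.exp (-(γ * (r ^ k / (k.factorial : ℝ)) * Real.exp (-r)))) := by
  obtain ⟨κ, hκ, hmean⟩ := hh.exists_bargmann_eq
  set σ : ℂ := (Real.sqrt γ : ℝ) * κ with hσ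
  have hσn : ‖σ‖ ^ 2 = γ * (Real.pi ^ k / k.factorial) := by
    rw [hσ, norm_mul, mul_pow, hκ, Complex.norm_real, Real.norm_eq_abs, sq_abs,
      Real.sq_sqrt hγ.le]
  have hm : Differentiable ℂ fun w : ℂ => σ * w ^ k := by fun_prop
  have hval : ∀ ω w, (ξ ω + ((Real.sqrt γ : ℝ) : ℂ) • (h : 𝓢'(ℝ, ℂ))) (coherent w) =
      σ * w ^ k + ξ ω (coherent w) := fun ω w => by
    have h1 : (ξ ω + ((Real.sqrt γ : ℝ) : ℂ) • (h : 𝓢'(ℝ, ℂ))) (coherent w) =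
      ξ ω (coherent w) + ((Real.sqrt γ : ℝ) : ℂ) * (h : 𝓢'(ℝ, ℂ)) (coherent w) := rfl
    rw [h1, hmean, hσ]
    ring
  have hconj : MeasurePreserving (starRingEnd ℂ) (volume : Measure ℂ) volume :=
    Complex.conjLIE.measurePreserving
  have hcount : ∀ A : Set ℂ, MeasurableSet A → Bornology.IsBounded A →
      AEMeasurable (fun ω => zeroCount (ξ ω + ((Real.sqrt γ : ℝ) : ℂ) • (h : 𝓢'(ℝ, ℂ))) A) P ∧
      ∫⁻ ω, zeroCount (ξ ω + ((Real.sqrt γ : ℝ) : ℂ) • (h : 𝓢'(ℝ, ℂ))) A ∂P =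
        ∫⁻ z in A, ENNReal.ofReal (zeroIntensity (fun w => σ * w ^ k) (starRingEnd ℂ z)) := by
    intro A hA hAb
    have hAb' : Bornology.IsBounded (starRingEnd ℂ ⁻¹' A) := by
      obtain ⟨R, hR⟩ := hAb.subset_closedBall 0
      refine Metric.isBounded_closedBall.subset (t := Metric.closedBall 0 R) fun z hz => ?_
      simpa using hR hz
    have hmain := aemeasurable_and_lintegral_count_zeros hξ hm (hconj.measurable hA) hAb'
    simp_rw [zeroCount_eq_count hA, hval]
    refine ⟨hmain.1, hmain.2.trans ?_⟩
    rw [← hconj.setLIntegral_comp_preimage_emb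
      Complex.conjLIE.toHomeomorph.measurableEmbedding _ A]
    refine lintegral_congr fun z => ?_
    simp
  refine ⟨by fun_prop, fun z => ?_, fun A hA hAb => (hcount A hA hAb).1, fun A hA hAb => ?_⟩
  · dsimp only
    positivity
  · rw [(hcount A hA hAb).2]
    refine lintegral_congr fun z => ?_
    rw [zeroIntensity_monomial hk hσn, Complex.norm_conj]
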